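/- For a positive integer $n$ and a subset $S\subseteq\mathbb{Z}_n\setminus\{0\}$ with $S=-S$, let $\mathrm{Cay}(\mathbb{Z}_n,S)$ be the (simple, undirected) circulant graph with vertex set $\mathbb{Z}_n$ in which $v$ and $w$ are adjacent if and only if $w-v\in S$. For a graph $X$, the canonical bipartite double cover $BX$ is the graph on $V(X)\times\{0,1\}$ in which $(v,0)$ is adjacent to $(w,1)$ if and only if $v$ is adjacent to $w$ in $X$ (and there are no other edges); $X$ is unstable if $\operatorname{Aut} BX\neq \operatorname{Aut} X\times S_2$, where $S_2$ is the symmetric group on $\{0,1\}$. The graph $X$ is nontrivially unstable if it is unstable, connected and nonbipartite, and no two distinct vertices of $X$ have the same set of neighbors. Theorem. Let $X=\mathrm{Cay}(\mathbb{Z}_n,S)$ be a nontrivially unstable circulant graph of valency $6$. Then $n$ is even and, with $S_e=S\cap 2\mathbb{Z}_n$ and $S_o=S\setminus S_e$, at least one of the following conditions holds. (C.1) There is a nonzero element $h$ of $2\mathbb{Z}_n$ such that $h+S_e=S_e$. (C.2$'$) $n$ is divisible by $4$, and there exists $h\in 1+2\mathbb{Z}_n$ such that $2h+S_o=S_o$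 and, for each $s\in S$ with $s\equiv 0$ or $s\equiv -h \pmod 4$, we have $s+h\in S$. (C.3$'$) There is a subgroup $H$ of $\mathbb{Z}_n$ such that the set $R=\{s\in S \mid s+H\not\subseteq S\}$ is nonempty and, for $d=\gcd(R\cup\{n\})$, the quotient $n/d$ is even, $r/d$ is odd for every $r\in R$, and either $H\not\subseteq d\mathbb{Z}_n$ or $H\subseteq 2d\mathbb{Z}_n$. (C.4) There exists $m\in\mathbb{Z}_n^\times$ such that $(n/2)+mS=S$. -/

import Mathlib

/-- A graph `G` is unstable if `Aut BG ≠ Aut G × S₂`, where `BG` is the canonical bipartite double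
cover of `G` (with vertex set `V ⊕ V`, two copies of `V`), i.e. some automorphism of `BG` does not
come from a pair `(α, σ)` with `α ∈ Aut G` and `σ` a permutation of the two copies. The pair
`(α, id)` acts as `Sum.map α α`; with the transposition as `σ`, it acts as
`Sum.swap ∘ Sum.map α α`. -/
def IsUnstableGraph {V : Type*} (G : SimpleGraph V) : Prop :=
  ∃ φ : G.bipartiteDoubleCover ≃g G.bipartiteDoubleCover,
    ¬ ∃ α : G ≃g G,
      (φ : V ⊕ V → V ⊕ V) = Sum.map α α ∨ (φ : V ⊕ V → V ⊕ V) = Sum.swap ∘ Sum.map α α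

/-- No two distinct vertices have the same set of neighbours. -/
def IsTwinFreeGraph {V : Type*} (G : SimpleGraph V) : Prop :=
  ∀ v w : V, G.neighborSet v = G.neighborSet w → v = w

/-- Connected, nonbipartite, twin-free and unstable. -/
def IsNontriviallyUnstable {V : Type*} (G : SimpleGraph V) : Prop :=
  G.Connected ∧ ¬ G.IsBipartite ∧ IsTwinFreeGraph G ∧ IsUnstableGraph G

section WilsonTypes

open Classical in
/-- `S_e = S ∩ 2ℤ_n`. -/
noncomputable def evenPart {n : ℕ} (S : Finset (ZMod n)) : Finset (ZMod n) :=
  {s ∈ S | s ∈ AddSubgroup.zmultiples (2 : ZMod n)}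

/-- `S_o = S \ S_e`. -/
noncomputable def oddPart {n : ℕ} (S : Finset (ZMod n)) : Finset (ZMod n) :=
  S \ evenPart S

/-- Wilson type C.1: `n` is even and some nonzero `h ∈ 2ℤ_n` satisfies `h + S_e = S_e`. -/
def WilsonC1 {n : ℕ} (S : Finset (ZMod n)) : Prop :=
  Even n ∧ ∃ h ∈ AddSubgroup.zmultiples (2 : ZMod n), h ≠ 0 ∧
    (evenPart S).image (fun s => h + s) = evenPart S

/-- Wilson type C.2': `n` is divisible by `4` and there is `h ∈ 1 + 2ℤ_n` such that
`2h + S_o = S_o`, and `s + h ∈ S` for each `s ∈ S` with `s ≡ 0` or `s ≡ -h (mod 4)`.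
(As `4 ∣ n`, congruence modulo `4` is congruence modulo the subgroup `4ℤ_n`.) -/
def WilsonC2' {n : ℕ} (S : Finset (ZMod n)) : Prop :=
  4 ∣ n ∧ ∃ h : ZMod n, h - 1 ∈ AddSubgroup.zmultiples (2 : ZMod n) ∧
    (oddPart S).image (fun s => 2 * h + s) = oddPart S ∧
    ∀ s ∈ S, (s ∈ AddSubgroup.zmultiples (4 : ZMod n) ∨
      s - (-h) ∈ AddSubgroup.zmultiples (4 : ZMod n)) → s + h ∈ S

open Classical in
/-- `R = {s ∈ S | s + H ⊈ S}`. -/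
noncomputable def wilsonR {n : ℕ} (S : Finset (ZMod n)) (H : AddSubgroup (ZMod n)) :
    Finset (ZMod n) :=
  {s ∈ S | ¬ ∀ h ∈ H, s + h ∈ S}

/-- `gcd (R ∪ {n})`, the elements of `R` being represented by integers in `{0, …, n - 1}`. -/
def gcdWithOrder {n : ℕ} (R : Finset (ZMod n)) : ℕ :=
  Nat.gcd (R.gcd ZMod.val) n

/-- Wilson type C.3': `n` is even and there is a subgroup `H` of `ℤ_n` such that
`R = {s ∈ S | s + H ⊈ S}` is nonempty and, for `d = gcd (R ∪ {n})`: `n / d` is even, `r / d` is odd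
for every `r ∈ R`, and either `H ⊈ dℤ_n` or `H ⊆ 2dℤ_n`. (`d` divides `n` and every `r ∈ R`, so
the divisions are exact; as `n / d` is even, the parity of `r / d` does not depend on the integer
representing `r`.) -/
def WilsonC3' {n : ℕ} (S : Finset (ZMod n)) : Prop :=
  Even n ∧ ∃ H : AddSubgroup (ZMod n), (wilsonR S H).Nonempty ∧
    ∃ d : ℕ, d = gcdWithOrder (wilsonR S H) ∧
      Even (n / d) ∧ (∀ r ∈ wilsonR S H, Odd (r.val / d)) ∧
      (¬ H ≤ AddSubgroup.zmultiples (d : ZMod n) ∨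
        H ≤ AddSubgroup.zmultiples ((2 * d : ℕ) : ZMod n))

/-- Wilson type C.4: `n` is even and `n/2 + mS = S` for some unit `m` of `ℤ_n`. -/
def WilsonC4 {n : ℕ} (S : Finset (ZMod n)) : Prop :=
  Even n ∧ ∃ m : (ZMod n)ˣ,
    S.image (fun s => ((n / 2 : ℕ) : ZMod n) + (m : ZMod n) * s) = S

end WilsonTypes

/-! The double cover is the Cayley graph of ℤ_n × ℤ₂ with connection set `T = S × {1}`, and
instability yields an automorphism φ of it with φ(0) = 0 and φ(0,1) ≠ (0,1). Such a φ maps two-step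
paths to two-step paths, so it preserves every set of differences cut out by counting
representations z = u + v with u, v in sets already preserved (`PreservesDiff.of_repCount`).
Swapping u and v shows that an odd count in T + T singles out doubles of elements of T. The aim is
either to isolate the directions of T, which makes φ additive, so that φ(x,i) = (mx + i·n/2, i) and
C.4 holds; or to show that {(0,1)} is preserved, a contradiction; or to read off C.2' or C.3' from
the arithmetic of S.

For odd n, repeated doubling turns S × {1} into S × {0}; then φ(0,1) ≠ (0,1) would produce twins.

For even n, S = {±a, ±b, ±c}, and x ↦ (n/2)x records parity. Connectedness and nonbipartiteness
allow a, b of equal parity and c of the other. Suppose first that no two of 2a, 2b, 2c agree up to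
sign. Parity leaves few coincidences between sums of two elements: 2c = ±a ± b, b = ±3a or a = ±3b.
In each case, and without coincidences, φ is additive, except that with b = 3a and 10a = 0 (up to
signs and exchange of a, b) the singleton {(0,1)} is preserved (`wilsonC4_of_two_mul_ne`).

Otherwise, after relabelling, b = a + n/2, and the order of c decides
(`IsSextuple.wilsonC2'_or_wilsonC3'`). If 4 divides it, C.3' holds with H = ⟨n/2⟩. If not, and 2a =
±2c + n/2, then C.2' holds when c has odd order, and {(0,1)} is preserved when it has twice an odd
order. In the remaining case ±(c,1) is a preserved direction; an odd multiple of it of order two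
leads to (0,1), unless 4a = n/2, when C.3' holds with H = ⟨2a⟩. Condition C.1 is never needed. -/

set_option linter.unusedSectionVars false

/-! ### Difference sets preserved by a permutation, and parallel increments. -/

section DifferencePreservation

variable {G : Type*} [CommRing G] [DecidableEq G]

/-- The permutation `φ` is an automorphism of the Cayley digraph with connection set `U`. -/
def PreservesDiff (φ : Equiv.Perm G) (U : Finset G) : Prop :=
  ∀ x y, φ y - φ x ∈ U ↔ y - x ∈ U

/-- The number of representations of `x` as a sum of an element of `U` and one of `V`. -/
def repCount (U V : Finset G) (x : G) : ℕ := {u ∈ U | x - u ∈ V}.card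

/-- `φ` respects the additive structure for the pair of increments `s`, `t`. -/
def Parallel (φ : Equiv.Perm G) (s t : G) : Prop :=
  ∀ x, φ (x + s + t) - φ (x + s) = φ (x + t) - φ x

variable {φ : Equiv.Perm G} {T U V W : Finset G}

/-- The substitution u ↦ φ(x + u) − φ(x) matches the two-step paths from x to y with those from φ(x)
to φ(y). -/
theorem repCount_preserved (hU : PreservesDiff φ U) (hV : PreservesDiff φ V) (x y : G) :
    repCount U V (φ y - φ x) = repCount U V (y - x) := by
  unfold repCount
  symm
  refine Finset.card_equiv (((Equiv.addLeft x).trans φ).trans (Equiv.subRight (φ x))) fun u => ?_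
  have h1 := hU x (x + u)
  have h2 := hV (x + u) y
  rw [add_sub_cancel_left] at h1
  simp only [Finset.mem_filter, Equiv.trans_apply, Equiv.coe_addLeft, Equiv.subRight_apply]
  rw [h1, show φ y - φ x - (φ (x + u) - φ x) = φ y - φ (x + u) by ring, h2,
    show y - x - u = y - (x + u) by ring]

/-- The main tool: new preserved sets arise from old ones by any condition on representation counts.
-/
theorem PreservesDiff.of_repCount (hU : PreservesDiff φ U) (hV : PreservesDiff φ V)
    (p : ℕ → Prop) (h : ∀ z, z ∈ W ↔ p (repCount U V z)) : PreservesDiff φ W := fun x y => by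
  rw [h, h, repCount_preserved hU hV]

theorem PreservesDiff.of_mem_repCount (hT : PreservesDiff φ T) (hU : PreservesDiff φ U)
    (hV : PreservesDiff φ V) (p : ℕ → Prop) (h : ∀ z, z ∈ W ↔ z ∈ T ∧ p (repCount U V z)) :
    PreservesDiff φ W := fun x y => by
  rw [h, h, hT, repCount_preserved hU hV]

theorem PreservesDiff.sdiff (hU : PreservesDiff φ U) (hV : PreservesDiff φ V) :
    PreservesDiff φ (U \ V) := fun x y => by
  rw [Finset.mem_sdiff, Finset.mem_sdiff, hU, hV]

theorem PreservesDiff.apply_add_mem (hU : PreservesDiff φ U) {u : G} (hu : u ∈ U) (x : G) :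
    φ (x + u) - φ x ∈ U := by
  rw [hU]; simpa using hu

theorem PreservesDiff.apply_add_of_singleton {g : G} (h : PreservesDiff φ {g}) (x : G) :
    φ (x + g) = φ x + g := by
  have := h.apply_add_mem (Finset.mem_singleton_self g) x
  rw [Finset.mem_singleton] at this
  linear_combination this

theorem PreservesDiff.apply_add {g : G} (h : PreservesDiff φ {g, -g}) (x : G) :
    φ (x + g) = φ x + g ∨ φ (x + g) = φ x - g := by
  have := h.apply_add_mem (Finset.mem_insert_self g _) x
  rw [Finset.mem_insert, Finset.mem_singleton] at this
  rcases this with h | h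
  · left; linear_combination h
  · right; linear_combination h

/-- φ maps {x + g, x − g} injectively into {φ(x) + g, φ(x) − g}, hence onto it; this gives the
direction of the equivalence that is not assumed. -/
theorem PreservesDiff.pair_of_apply_add {g : G}
    (h : ∀ x, φ (x + g) = φ x + g ∨ φ (x + g) = φ x - g) : PreservesDiff φ {g, -g} := by
  intro x y
  simp only [Finset.mem_insert, Finset.mem_singleton]
  have h1 := h x
  have h2 := h (x - g)
  rw [sub_add_cancel] at h2
  have h2' : φ (x - g) = φ x + g ∨ φ (x - g) = φ x - g := by
    rcases h2 with h2 | h2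
    · right; rw [h2]; ring
    · left; rw [h2]; ring
  have key : φ (x + g) = φ (x - g) → (g = -g) := fun e => by
    have := φ.injective e
    linear_combination this
  constructor
  · rintro (e | e)
    · have e : φ y = φ x + g := by linear_combination e
      rcases h1 with h1 | h1
      · left; rw [← h1] at e; rw [φ.injective e]; ring
      · rcases h2' with h2' | h2'
        · right; rw [← h2'] at e; rw [φ.injective e]; ring
        · have hg := key (h1.trans h2'.symm)
          left
          rw [hg, ← sub_eq_add_neg, ← h1] at e
          rw [φ.injective e]; ring
    · have e : φ y = φ x - g := by linear_combination e
      rcases h1 with h1 | h1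
      · rcases h2' with h2' | h2'
        · have hg := key (h1.trans h2'.symm)
          left
          rw [hg, sub_neg_eq_add, ← h1] at e
          rw [φ.injective e]; ring
        · right; rw [← h2'] at e; rw [φ.injective e]; ring
      · left; rw [← h1] at e; rw [φ.injective e]; ring
  · rintro (e | e)
    · obtain rfl : y = x + g := by linear_combination e
      rcases h1 with h1 | h1
      · left; rw [h1]; ring
      · right; rw [h1]; ring
    · obtain rfl : y = x - g := by linear_combination e
      rcases h2' with h1 | h1
      · left; rw [h1]; ring
      · right; rw [h1]; ring

/-- Along a line in a preserved direction, `φ` does not turn around. -/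
theorem PreservesDiff.apply_add_mul {g : G} (h : PreservesDiff φ {g, -g}) (x : G) :
    (∀ k : ℕ, φ (x + k * g) = φ x + k * g) ∨ (∀ k : ℕ, φ (x + k * g) = φ x - k * g) := by
  -- Turning back would give φ(z + 2g) = φ(z), so 2g = 0, and then +g and −g are the same step.
  have turn : ∀ z, (φ (z + g) = φ z + g → φ (z + g + g) = φ (z + g) + g) ∧
      (φ (z + g) = φ z - g → φ (z + g + g) = φ (z + g) - g) := by
    intro z
    have key : φ (z + g + g) = φ z → φ (z + g) + g = φ (z + g) - g := fun e => by
      have := φ.injective e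
      linear_combination this
    rcases h.apply_add (z + g) with e | e
    · refine ⟨fun _ => e, fun e' => ?_⟩
      rw [← key (by rw [e, e']; ring)]; exact e
    · refine ⟨fun e' => ?_, fun _ => e⟩
      rw [key (by rw [e, e']; ring)]; exact e
  have step : ∀ k : ℕ, x + (k + 1 : ℕ) * g = x + k * g + g := fun k => by push_cast; ring
  rcases h.apply_add x with e | e
  · left
    have : ∀ k : ℕ, φ (x + k * g) = φ x + k * g ∧ φ (x + k * g + g) = φ (x + k * g) + g := by
      intro k
      induction k with
      | zero => simpa using e
      | succ k ih =>
        rw [step k]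
        refine ⟨?_, (turn _).1 ih.2⟩
        rw [ih.2, ih.1]; push_cast; ring
    exact fun k => (this k).1
  · right
    have : ∀ k : ℕ, φ (x + k * g) = φ x - k * g ∧ φ (x + k * g + g) = φ (x + k * g) - g := by
      intro k
      induction k with
      | zero => simpa using e
      | succ k ih =>
        rw [step k]
        refine ⟨?_, (turn _).2 ih.2⟩
        rw [ih.2, ih.1]; push_cast; ring
    exact fun k => (this k).1

theorem PreservesDiff.mul_pair {g : G} (h : PreservesDiff φ {g, -g}) (k : ℕ) :
    PreservesDiff φ {(k : G) * g, -((k : G) * g)} :=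
  .pair_of_apply_add fun x => (h.apply_add_mul x).imp (fun h => h k) (fun h => h k)

/-- Multiples of order two of a preserved direction are commuting translations. -/
theorem PreservesDiff.singleton_of_two_mul_eq_zero {g : G} (h : PreservesDiff φ {g, -g})
    (hg : 2 * g = 0) : PreservesDiff φ {g} := by
  have : -g = g := by linear_combination -hg
  simpa [this] using h

theorem PreservesDiff.add_singleton {g h : G} (hg : PreservesDiff φ {g})
    (hh : PreservesDiff φ {h}) : PreservesDiff φ {g + h} := by
  intro x y
  have e : ∀ x, φ (x + (g + h)) = φ x + (g + h) := fun x => by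
    rw [← add_assoc, hh.apply_add_of_singleton, hg.apply_add_of_singleton, add_assoc]
  simp only [Finset.mem_singleton, sub_eq_iff_eq_add', ← e, φ.injective.eq_iff]

namespace Parallel

theorem symm {s t : G} (h : Parallel φ s t) : Parallel φ t s := fun x => by
  have := h x
  rw [show x + t + s = x + s + t by ring]
  linear_combination this

theorem zero_right (s : G) : Parallel φ s 0 := fun x => by simp

theorem add_right {s t u : G} (ht : Parallel φ s t) (hu : Parallel φ s u) :
    Parallel φ s (t + u) := fun x => by
  have h1 := ht x
  have h2 := hu (x + t)
  rw [show x + t + s + u = x + s + (t + u) by ring, show x + t + s = x + s + t by ring,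
    show x + t + u = x + (t + u) by ring] at h2
  linear_combination h1 + h2

theorem neg_right {s t : G} (ht : Parallel φ s t) : Parallel φ s (-t) := fun x => by
  have h1 := ht (x - t)
  rw [show x - t + s + t = x + s by ring, show x - t + s = x + s + -t by ring,
    show x - t + t = x by ring, show x - t = x + -t by ring] at h1
  linear_combination -h1

/-- The increments parallel to `s` form a subgroup. -/
def subgroup (φ : Equiv.Perm G) (s : G) : AddSubgroup G where
  carrier := {t | Parallel φ s t}
  zero_mem' := zero_right s
  add_mem' := add_right
  neg_mem' := neg_right

/-- It suffices to check parallelism on generators. -/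
theorem of_closure {X : Set G} (h : ∀ s ∈ X, ∀ t ∈ X, Parallel φ s t) {s t : G}
    (hs : s ∈ AddSubgroup.closure X) (ht : t ∈ AddSubgroup.closure X) : Parallel φ s t := by
  have h1 : ∀ s ∈ X, ∀ t ∈ AddSubgroup.closure X, Parallel φ s t := fun s hs t ht =>
    (AddSubgroup.closure_le (K := subgroup φ s)).2 (h s hs) ht
  exact symm ((AddSubgroup.closure_le (K := subgroup φ t)).2 (fun s hs => (h1 s hs t ht).symm) hs)

end Parallel

theorem PreservesDiff.parallel_self {g : G} (h : PreservesDiff φ {g, -g}) : Parallel φ g g := by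
  intro x
  rcases h.apply_add_mul x with e | e
  all_goals
    have h1 := e 1
    have h2 := e 2
    simp only [Nat.cast_one, one_mul] at h1
    rw [show x + ((2 : ℕ) : G) * g = x + g + g by push_cast; ring] at h2
    rw [h2, h1]; push_cast; ring

/-- The image of the parallelogram x, x + g, x + h, x + g + h has sides ±g, ±h and must close up. If
opposite h-sides differed, 2h would be 0 or ±2g; the former makes h = −h, the latter is excluded. -/
theorem PreservesDiff.parallel {g h : G} (hg : PreservesDiff φ {g, -g})
    (hh : PreservesDiff φ {h, -h}) (h1 : 2 * g ≠ 2 * h) (h2 : 2 * g ≠ -(2 * h)) :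
    Parallel φ g h := by
  intro x
  have a1 := hg.apply_add x
  have a2 := hh.apply_add x
  have a3 := hh.apply_add (x + g)
  have a4 := hg.apply_add (x + h)
  rw [show x + h + g = x + g + h by ring] at a4
  rcases a1 with a1 | a1 <;> rcases a2 with a2 | a2 <;> rcases a3 with a3 | a3 <;>
    rcases a4 with a4 | a4 <;>
    grind

end DifferencePreservation

/-! ### Parity of representation counts, and counts forcing parallelism. -/

section RepresentationCounts

variable {G : Type*} [CommRing G] [DecidableEq G]
variable {φ : Equiv.Perm G} {T U V W : Finset G}

/-- The involution s ↦ x − s on the representations has the solutions of 2s = x as fixed points. -/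
theorem repCount_self_mod_two (T : Finset G) (x : G) :
    (repCount T T x : ZMod 2) = ({s ∈ T | 2 * s = x}.card : ZMod 2) := by
  unfold repCount
  have h0 : ∑ s ∈ {s ∈ {s ∈ T | x - s ∈ T} | ¬ 2 * s = x}, (1 : ZMod 2) = 0 := by
    refine Finset.sum_involution (fun s _ => x - s) (fun _ _ => by decide) ?_ ?_ ?_
    · intro s hs _ e
      simp only [Finset.mem_filter] at hs
      exact hs.2 (by linear_combination -e)
    · intro s hs
      simp only [Finset.mem_filter] at hs ⊢
      refine ⟨⟨hs.1.2, by simpa using hs.1.1⟩, fun e => hs.2 ?_⟩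
      linear_combination -e
    · intro s _; ring
  have h1 : ({s ∈ T | 2 * s = x} : Finset G) = {s ∈ {s ∈ T | x - s ∈ T} | 2 * s = x} := by
    ext s
    simp only [Finset.mem_filter]
    constructor
    · rintro ⟨h, rfl⟩
      refine ⟨⟨h, ?_⟩, rfl⟩
      rwa [two_mul, add_sub_cancel_right]
    · tauto
  rw [h1, ← Finset.card_filter_add_card_filter_not (s := {s ∈ T | x - s ∈ T}) (fun s => 2 * s = x)]
  rw [Finset.sum_const, nsmul_one] at h0
  rw [Nat.cast_add, h0, add_zero]

theorem exists_two_mul_eq_of_odd {x : G} (h : Odd (repCount T T x)) : ∃ s ∈ T, x = 2 * s := by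
  by_contra! hne
  have := repCount_self_mod_two T x
  rw [Finset.filter_false_of_mem fun s hs e => hne s hs e.symm, Finset.card_empty, Nat.cast_zero,
    ZMod.natCast_eq_zero_iff_even] at this
  exact Nat.not_odd_iff_even.2 this h

theorem repCount_neg (hU : ∀ u ∈ U, -u ∈ U) (hV : ∀ v ∈ V, -v ∈ V) (x : G) :
    repCount U V (-x) = repCount U V x := by
  refine Finset.card_equiv (Equiv.neg G) fun u => ?_
  have h1 : -u ∈ U ↔ u ∈ U := ⟨fun h => by simpa using hU _ h, hU u⟩
  have h2 : x + u ∈ V ↔ -x - u ∈ V :=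
    ⟨fun h => by convert hV _ h using 1; ring, fun h => by convert hV _ h using 1; ring⟩
  simp [h1, h2]

theorem repCount_pair {u : G} (hu : u ≠ -u) (x : G) :
    repCount {u, -u} V x = (if x - u ∈ V then 1 else 0) + (if x + u ∈ V then 1 else 0) := by
  unfold repCount
  rw [Finset.card_filter, Finset.sum_pair hu, sub_neg_eq_add]

theorem repCount_ne_zero_of_mem {u x : G} (hu : u ∈ U) (h : x - u ∈ V) : repCount U V x ≠ 0 :=
  Finset.card_ne_zero.2 ⟨u, Finset.mem_filter.2 ⟨hu, h⟩⟩

theorem repCount_eq_zero {x : G} (h : ∀ u ∈ U, x - u ∉ V) : repCount U V x = 0 :=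
  Finset.card_eq_zero.2 (Finset.filter_false_of_mem h)

theorem exists_of_repCount_ne_zero {x : G} (h : repCount U V x ≠ 0) : ∃ u ∈ U, x - u ∈ V := by
  obtain ⟨u, hu⟩ := Finset.card_ne_zero.1 h
  exact ⟨u, Finset.mem_filter.1 hu⟩

theorem mem_of_repCount_eq_one {s t u : G} (hs : s ∈ U) (ht : t ∈ V) (h : repCount U V (s + t) = 1)
    (hu : u ∈ U) (hu' : s + t - u ∈ V) : u = s := by
  obtain ⟨x, hx⟩ := Finset.card_eq_one.1 h
  have h1 : s ∈ ({u ∈ U | s + t - u ∈ V} : Finset G) := by simp [hs, ht]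
  have h2 : u ∈ ({u ∈ U | s + t - u ∈ V} : Finset G) := by simp [hu, hu']
  rw [hx, Finset.mem_singleton] at h1 h2
  rw [h1, h2]

theorem mem_of_repCount_eq_two {s t u : G} (hs : s ∈ U) (ht : t ∈ U) (hst : s ≠ t)
    (h : repCount U U (s + t) = 2) (hu : u ∈ U) (hu' : s + t - u ∈ U) : u = s ∨ u = t := by
  have hsub : ({s, t} : Finset G) ⊆ ({u ∈ U | s + t - u ∈ U} : Finset G) := by
    intro z hz
    rw [Finset.mem_insert, Finset.mem_singleton] at hz
    rcases hz with rfl | rfl <;> simp [hs, ht]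
  have heq := Finset.eq_of_subset_of_card_le hsub (by
    rw [Finset.card_pair hst]; exact h.le)
  have h2 : u ∈ ({u ∈ U | s + t - u ∈ U} : Finset G) := by simp [hu, hu']
  rw [← heq] at h2
  simpa using h2

theorem forall_mem_of_repCount_eq_card {x : G} (h : repCount U V x = U.card) :
    ∀ u ∈ U, x - u ∈ V := Finset.card_filter_eq_iff.1 h

theorem repCount_eq_card {x : G} (h : ∀ u ∈ U, x - u ∈ V) : repCount U V x = U.card :=
  Finset.card_filter_eq_iff.2 h

/-- If p, q are the images of the two steps s, then q + p is a representation as well as p + q;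
uniqueness gives p = q. -/
theorem PreservesDiff.parallel_self_of_repCount_eq_one (hT : PreservesDiff φ T) {s : G}
    (hs : s ∈ T) (h : repCount T T (2 * s) = 1) : Parallel φ s s := by
  intro x
  have h1 := hT.apply_add_mem hs x
  have h2 := hT.apply_add_mem hs (x + s)
  have h3 := repCount_preserved hT hT x (x + s + s)
  rw [show x + s + s - x = 2 * s by ring, h,
    show φ (x + s + s) - φ x = (φ (x + s) - φ x) + (φ (x + s + s) - φ (x + s)) by ring] at h3
  exact mem_of_repCount_eq_one h1 h2 h3 h2 (by simpa using h1)

/-- The path through x + t is a second path from x to x + s + t. If p ≠ q are the image steps of the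
path through x + s, the only representations are p + q and q + p, and injectivity of φ forces the
second path to start with q. -/
theorem PreservesDiff.parallel_of_repCount_eq_two (hT : PreservesDiff φ T) {s t : G}
    (hs : s ∈ T) (ht : t ∈ T) (hst : s ≠ t) (h : repCount T T (s + t) = 2)
    (hne : ∀ x, φ (x + s + t) - φ (x + s) ≠ φ (x + s) - φ x) : Parallel φ s t := by
  intro x
  have h1 := hT.apply_add_mem hs x
  have h2 := hT.apply_add_mem ht (x + s)
  have h3 := repCount_preserved hT hT x (x + s + t)
  rw [show x + s + t - x = s + t by ring, h,
    show φ (x + s + t) - φ x = (φ (x + s) - φ x) + (φ (x + s + t) - φ (x + s)) by ring] at h3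
  have h4 := hT.apply_add_mem ht x
  have h5 := hT.apply_add_mem hs (x + t)
  rcases mem_of_repCount_eq_two h1 h2 (hne x).symm h3 h4 (by
    convert h5 using 1; rw [show x + t + s = x + s + t by ring]; ring) with e | e
  · have : φ (x + t) = φ (x + s) := by linear_combination e
    exact absurd (by linear_combination -φ.injective this) hst
  · exact e.symm

/-- If straight paths of length two are the only paths between their endpoints and `s + t` is
represented by `s, t` only, then `φ` does not turn along `s`, `t`. -/
theorem PreservesDiff.parallel_of_repCount (hT : PreservesDiff φ T) (hneg : ∀ s ∈ T, -s ∈ T)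
    (hself : ∀ s ∈ T, s ≠ -s) (h1 : ∀ s ∈ T, 4 * s ≠ 0 → repCount T T (2 * s) = 1)
    (hquad : ∀ s ∈ T, ∀ t ∈ T, 4 * s = 0 → 4 * t = 0 → s = t ∨ s = -t) :
    (∀ s ∈ T, Parallel φ s s) ∧
    ∀ s ∈ T, ∀ t ∈ T, s ≠ t → s ≠ -t → repCount T T (s + t) = 2 → Parallel φ s t := by
  -- A count equal to 1 is odd, hence attained only at doubles; it excludes 4s = 0, since then 2s is
  -- also (−s) + (−s).
  have hO : PreservesDiff φ ({s ∈ T | 4 * s ≠ 0}.image (2 * ·)) := by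
    refine hT.of_repCount hT (· = 1) fun z => ?_
    simp only [Finset.mem_image, Finset.mem_filter]
    constructor
    · rintro ⟨s, ⟨hs, h4⟩, rfl⟩
      exact h1 s hs h4
    · intro hz
      obtain ⟨s, hs, rfl⟩ := exists_two_mul_eq_of_odd (hz ▸ odd_one : Odd (repCount T T z))
      refine ⟨s, ⟨hs, fun h4 => ?_⟩, rfl⟩
      rw [two_mul] at hz
      exact hself s hs (mem_of_repCount_eq_one hs hs hz (hneg s hs) (by
        convert hneg s hs using 1; linear_combination h4)).symm
  -- An element t is recognised by t = 2t + (−t); conversely t = 2s + u with u in T forces t = s by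
  -- uniqueness of the representation of 2s.
  have hT1 : PreservesDiff φ {s ∈ T | 4 * s ≠ 0} := by
    refine hT.of_mem_repCount hT hO (· ≠ 0) fun t => ?_
    rw [Finset.mem_filter]
    refine and_congr_right fun ht => ⟨fun h4 => ?_, fun h h4 => ?_⟩
    · refine repCount_ne_zero_of_mem (hneg t ht) (Finset.mem_image.2 ⟨t, ?_, by ring⟩)
      exact Finset.mem_filter.2 ⟨ht, h4⟩
    · obtain ⟨u, hu, hu'⟩ := exists_of_repCount_ne_zero h
      obtain ⟨s, hs, e⟩ := Finset.mem_image.1 hu'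
      rw [Finset.mem_filter] at hs
      have := h1 s hs.1 hs.2
      rw [two_mul] at this
      have := mem_of_repCount_eq_one hs.1 hs.1 this ht (by
        convert hneg u hu using 1; linear_combination e)
      exact hs.2 (this ▸ h4)
  refine ⟨fun s hs => ?_, fun s hs t ht hst hst' h2 => ?_⟩
  · by_cases h4 : 4 * s = 0
    · have : T \ {s ∈ T | 4 * s ≠ 0} = {s, -s} := by
        ext t
        simp only [Finset.mem_sdiff, Finset.mem_filter, Finset.mem_insert, Finset.mem_singleton]
        constructor
        · rintro ⟨ht, ht'⟩
          have h4' : 4 * t = 0 := by by_contra h; exact ht' ⟨ht, h⟩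
          exact hquad t ht s hs h4' h4
        · rintro (rfl | rfl)
          · exact ⟨hs, fun h => h.2 h4⟩
          · exact ⟨hneg s hs, fun h => h.2 (by linear_combination -h4)⟩
      exact (this ▸ hT.sdiff hT1).parallel_self
    · exact hT.parallel_self_of_repCount_eq_one hs (h1 s hs h4)
  -- If both image steps were equal to p, the count of 2p would be 2; so 4p = 0, hence 4s = 4t = 0
  -- and s = ±t.
  · refine hT.parallel_of_repCount_eq_two hs ht hst h2 fun x e => ?_
    have hT1' : ∀ u ∈ T, ∀ y, 4 * (φ (y + u) - φ y) = 0 → 4 * u = 0 := fun u hu y h => by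
      by_contra h'
      have := hT1.apply_add_mem (Finset.mem_filter.2 ⟨hu, h'⟩) y
      exact (Finset.mem_filter.1 this).2 h
    have hs' := hT.apply_add_mem hs x
    have h3 := repCount_preserved hT hT x (x + s + t)
    rw [show x + s + t - x = s + t by ring, h2, show φ (x + s + t) - φ x =
      (φ (x + s) - φ x) + (φ (x + s + t) - φ (x + s)) by ring, e, ← two_mul] at h3
    by_cases h4 : 4 * (φ (x + s) - φ x) = 0
    · rcases hquad s hs t ht (hT1' s hs x h4) (hT1' t ht (x + s) (e ▸ h4)) with h | h
      exacts [hst h, hst' h]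
    · rw [h1 _ hs' h4] at h3
      omega

end RepresentationCounts

/-! ### Connection sets {±a, ±b, ±c}; the case b = 3a. -/

section SextupleConnectionSets

variable {G : Type*} [CommRing G] [DecidableEq G]
variable {φ : Equiv.Perm G} {T U : Finset G} {a b c w : G}

/-- `T = {±a, ±b, ±c}`. -/
def IsSextuple (T : Finset G) (a b c : G) : Prop :=
  ∀ x, x ∈ T ↔ x = a ∨ x = -a ∨ x = b ∨ x = -b ∨ x = c ∨ x = -c

namespace IsSextuple

theorem swap_left (h : IsSextuple T a b c) : IsSextuple T b a c := fun x => by rw [h]; tauto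

theorem swap_right (h : IsSextuple T a b c) : IsSextuple T a c b := fun x => by rw [h]; tauto

theorem neg_left (h : IsSextuple T a b c) : IsSextuple T (-a) b c := fun x => by
  rw [h, neg_neg]; tauto

theorem neg_mid (h : IsSextuple T a b c) : IsSextuple T a (-b) c := h.swap_left.neg_left.swap_left

theorem neg_right (h : IsSextuple T a b c) : IsSextuple T a b (-c) :=
  h.swap_right.neg_mid.swap_right

theorem left_mem (h : IsSextuple T a b c) : a ∈ T := (h _).2 (by simp)

theorem mid_mem (h : IsSextuple T a b c) : b ∈ T := (h _).2 (by simp)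

theorem right_mem (h : IsSextuple T a b c) : c ∈ T := (h _).2 (by simp)

theorem neg_mem (h : IsSextuple T a b c) : ∀ x ∈ T, -x ∈ T := fun x hx => by
  rw [h] at hx ⊢
  rcases hx with rfl | rfl | rfl | rfl | rfl | rfl <;> simp

/-- An invariant count separating `±a` from `±b` and `±c` makes `±a` a preserved direction. -/
theorem preservesDiff_left (h : IsSextuple T a b c) (hT : PreservesDiff φ T)
    (hU : PreservesDiff φ U) (hneg : ∀ u ∈ U, -u ∈ U) (p : ℕ → Prop) (ha : p (repCount U T a))
    (hb : ¬ p (repCount U T b)) (hc : ¬ p (repCount U T c)) : PreservesDiff φ {a, -a} := by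
  refine hT.of_mem_repCount hU hT p fun z => ?_
  rw [Finset.mem_insert, Finset.mem_singleton]
  constructor
  · rintro (rfl | rfl)
    · exact ⟨h.left_mem, ha⟩
    · exact ⟨h.neg_mem _ h.left_mem, by rwa [repCount_neg hneg h.neg_mem]⟩
  · rintro ⟨hz, hp⟩
    rcases (h z).1 hz with rfl | rfl | rfl | rfl | rfl | rfl
    · simp
    · simp
    · exact absurd hp hb
    · rw [repCount_neg hneg h.neg_mem] at hp; exact absurd hp hb
    · exact absurd hp hc
    · rw [repCount_neg hneg h.neg_mem] at hp; exact absurd hp hc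

theorem parallel (h : IsSextuple T a b c) {X : Set G} (hX : ∀ s ∈ X, ∀ t ∈ X, Parallel φ s t)
    (ha : a ∈ AddSubgroup.closure X) (hb : b ∈ AddSubgroup.closure X)
    (hc : c ∈ AddSubgroup.closure X) : ∀ s ∈ T, ∀ t ∈ T, Parallel φ s t := by
  have hsub : ∀ s ∈ T, s ∈ AddSubgroup.closure X := by
    intro s hs
    rcases (h s).1 hs with rfl | rfl | rfl | rfl | rfl | rfl <;> simp_all
  exact fun s hs t ht => Parallel.of_closure hX (hsub s hs) (hsub t ht)

theorem parallel_of_pairwise (h : IsSextuple T a b c) (ha : Parallel φ a a) (hb : Parallel φ b b)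
    (hc : Parallel φ c c) (hab : Parallel φ a b) (hac : Parallel φ a c) (hbc : Parallel φ b c) :
    ∀ s ∈ T, ∀ t ∈ T, Parallel φ s t := by
  refine h.parallel (X := {a, b, c}) ?_ (AddSubgroup.subset_closure (by simp))
    (AddSubgroup.subset_closure (by simp)) (AddSubgroup.subset_closure (by simp))
  rintro s (rfl | rfl | rfl) t (rfl | rfl | rfl) <;> first | assumption | exact Parallel.symm ‹_›

theorem parallel_of_preservesDiff (h : IsSextuple T a b c) (ha : PreservesDiff φ {a, -a})
    (hb : PreservesDiff φ {b, -b}) (hc : PreservesDiff φ {c, -c})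
    (h1 : 2 * a ≠ 2 * b) (h2 : 2 * a ≠ -(2 * b)) (h3 : 2 * a ≠ 2 * c) (h4 : 2 * a ≠ -(2 * c))
    (h5 : 2 * b ≠ 2 * c) (h6 : 2 * b ≠ -(2 * c)) : ∀ s ∈ T, ∀ t ∈ T, Parallel φ s t :=
  h.parallel_of_pairwise ha.parallel_self hb.parallel_self hc.parallel_self
    (ha.parallel hb h1 h2) (ha.parallel hc h3 h4) (hb.parallel hc h5 h6)

end IsSextuple

/-- Below, w plays the role of n/2 and multiplication by w that of parity. A coincidence s + t = s'
+ t' times w becomes γw = 0, where γ is the coefficient of c, because wa enters an even number of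
times; so γ is even. These inequalities refute the odd cases. -/
theorem odd_mul_ne_zero (hw : w ≠ 0) (hw2 : 2 * w = 0) :
    3 * w ≠ 0 ∧ 5 * w ≠ 0 ∧ 7 * w ≠ 0 ∧ 9 * w ≠ 0 :=
  ⟨fun h => hw (by linear_combination h - hw2), fun h => hw (by linear_combination h - 2 * hw2),
    fun h => hw (by linear_combination h - 3 * hw2), fun h => hw (by linear_combination h - 4 * hw2)⟩

theorem repCount_le_two {u : G} (h : ∀ s ∈ T, u - s ∈ T → s = b ∨ s = c) :
    repCount T T u ≤ 2 :=
  (Finset.card_le_card (t := {b, c}) fun s hs => by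
    simpa using h s (Finset.mem_filter.1 hs).1 (Finset.mem_filter.1 hs).2).trans
    Finset.card_le_two

theorem repCount_eq_two {u : G} (hbc : b ≠ c) (h : ∀ s, s ∈ T ∧ u - s ∈ T ↔ s = b ∨ s = c) :
    repCount T T u = 2 :=
  Finset.card_eq_two.2 ⟨b, c, hbc, by ext s; simp [h]⟩

theorem repCount_eq_one {u : G} (h : ∀ s, s ∈ T ∧ u - s ∈ T ↔ s = b) : repCount T T u = 1 :=
  Finset.card_eq_one.2 ⟨b, by ext s; simp [h]⟩

theorem repCount_eq_three {u : G} (hab : a ≠ b) (hac : a ≠ c) (hbc : b ≠ c)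
    (h : ∀ s, s ∈ T ∧ u - s ∈ T ↔ s = a ∨ s = b ∨ s = c) : repCount T T u = 3 :=
  Finset.card_eq_three.2 ⟨a, b, c, hab, hac, hbc, by ext s; simp [h]⟩

namespace IsSextuple

/-- 2a = a + a = 3a − a = −a + 3a, and parity with the remaining hypotheses excludes other
representations. -/
theorem repCount_two_mul_left (h : IsSextuple T a (3 * a) c) (hw : w ≠ 0) (hw2 : 2 * w = 0)
    (hwc : w * c = w * a + w) (h6 : 6 * a ≠ 0) (h8 : 8 * a ≠ 0)
    (h1 : 2 * c ≠ 2 * a) (h2 : 2 * c ≠ -(2 * a)) (h5 : 2 * c ≠ 4 * a) (h7 : 2 * c ≠ -(4 * a)) :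
    repCount T T (2 * a) = 3 := by
  obtain ⟨hw3, hw5, hw7, hw9⟩ := odd_mul_ne_zero hw hw2
  refine repCount_eq_three (a := a) (b := -a) (c := 3 * a) (by grind) (by grind) (by grind)
    fun s => ?_
  rw [h, h]
  constructor
  · rintro ⟨rfl | rfl | rfl | rfl | rfl | rfl, e⟩
    · grind
    · grind
    · grind
    all_goals exfalso; rcases e with e | e | e | e | e | e <;> grind
  · rintro (rfl | rfl | rfl) <;> grind

/-- The connection set `{±a, ±3a, ±c}`. -/
theorem parallel_of_eq_three_mul (h : IsSextuple T a (3 * a) c) (hT : PreservesDiff φ T)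
    (hw : w ≠ 0) (hw2 : 2 * w = 0)
    (hwc : w * c = w * a + w) (h6 : 6 * a ≠ 0) (h8 : 8 * a ≠ 0) (h10 : 10 * a ≠ 0)
    (h2c : 2 * c ≠ 0) (h1 : 2 * c ≠ 2 * a) (h2 : 2 * c ≠ -(2 * a)) (h3 : 2 * c ≠ 6 * a)
    (h4 : 2 * c ≠ -(6 * a)) (h5 : 2 * c ≠ 4 * a) (h7 : 2 * c ≠ -(4 * a)) :
    ∀ s ∈ T, ∀ t ∈ T, Parallel φ s t := by
  have hw' := odd_mul_ne_zero hw hw2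
  have ha : repCount T T (2 * a) = 3 := h.repCount_two_mul_left hw hw2 hwc h6 h8 h1 h2 h5 h7
  have hb : repCount T T (2 * (3 * a)) ≤ 2 := repCount_le_two (b := 3 * a) (c := -(3 * a)) <| by
    intro s
    rw [h, h]
    rintro (rfl | rfl | rfl | rfl | rfl | rfl) (e | e | e | e | e | e) <;> grind
  have hc : repCount T T (2 * c) ≤ 2 := repCount_le_two (b := c) (c := -c) <| by
    intro s
    rw [h, h]
    rintro (rfl | rfl | rfl | rfl | rfl | rfl) (e | e | e | e | e | e) <;> grind
  -- Since 3 is odd, only doubles compete, and 6a and 2c have counts at most 2.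
  have hN : ∀ z, z ∈ ({2 * a, -(2 * a)} : Finset G) ↔ repCount T T z = 3 := by
    intro z
    simp only [Finset.mem_insert, Finset.mem_singleton]
    constructor
    · rintro (rfl | rfl)
      exacts [ha, (repCount_neg h.neg_mem h.neg_mem _).trans ha]
    · intro hz
      obtain ⟨s, hs, rfl⟩ := exists_two_mul_eq_of_odd (hz ▸ by decide : Odd (repCount T T z))
      have hb' := repCount_neg h.neg_mem h.neg_mem (2 * (3 * a))
      have hc' := repCount_neg h.neg_mem h.neg_mem (2 * c)
      rw [← mul_neg] at hb' hc'
      rcases (h s).1 hs with rfl | rfl | rfl | rfl | rfl | rfl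
      · simp
      · right; ring
      all_goals omega
  have h2a : PreservesDiff φ {2 * a, -(2 * a)} := hT.of_repCount hT (· = 3) hN
  have hne : 2 * a ≠ -(2 * a) := by grind
  -- Steps by ±2a stay in T twice from a, once from 3a and never from c; the counts 2, 1, 0 separate
  -- the three directions.
  have n1 : a - 2 * a ∈ T := (h _).2 (by grind)
  have n2 : a + 2 * a ∈ T := (h _).2 (by grind)
  have n3 : 3 * a - 2 * a ∈ T := (h _).2 (by grind)
  have n4 : 3 * a + 2 * a ∉ T := by
    rw [h]; rintro (e | e | e | e | e | e) <;> grind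
  have n5 : c - 2 * a ∉ T := by
    rw [h]; rintro (e | e | e | e | e | e) <;> grind
  have n6 : c + 2 * a ∉ T := by
    rw [h]; rintro (e | e | e | e | e | e) <;> grind
  have ra : repCount {2 * a, -(2 * a)} T a = 2 := by
    rw [repCount_pair hne, if_pos n1, if_pos n2]
  have rb : repCount {2 * a, -(2 * a)} T (3 * a) = 1 := by
    rw [repCount_pair hne, if_pos n3, if_neg n4]
  have rc : repCount {2 * a, -(2 * a)} T c = 0 := by
    rw [repCount_pair hne, if_neg n5, if_neg n6]
  have hU : ∀ u ∈ ({2 * a, -(2 * a)} : Finset G), -u ∈ ({2 * a, -(2 * a)} : Finset G) := by simp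
  have pa := h.preservesDiff_left hT h2a hU (· = 2) ra (by rw [rb]; simp) (by rw [rc]; simp)
  have pb := h.swap_left.preservesDiff_left hT h2a hU (· = 1) rb (by rw [ra]; simp)
    (by rw [rc]; simp)
  have pc := h.swap_right.swap_left.preservesDiff_left hT h2a hU (· = 0) rc (by rw [ra]; simp)
    (by rw [rb]; simp)
  exact h.parallel_of_preservesDiff pa pb pc (by grind) (by grind) (by grind) (by grind)
    (by grind) (by grind)

end IsSextuple

end SextupleConnectionSets

/-! ### The case b = 3a with 10a = 0. -/

section DecagonConnectionSets

variable {G : Type*} [CommRing G] [DecidableEq G]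
variable {φ : Equiv.Perm G} {T : Finset G} {a b c w : G}

namespace IsSextuple

/-- The connection set `{±a, ±3a, ±c}` with `10a = 0`. -/
theorem preservesDiff_of_ten_mul_eq_zero (h : IsSextuple T a (3 * a) c) (hT : PreservesDiff φ T)
    (hw : w ≠ 0) (hw2 : 2 * w = 0) (hwc : w * c = w * a + w) (h2a : 2 * a ≠ 0) (h10 : 10 * a = 0)
    (h2c : 2 * c ≠ 0) (h1 : 2 * c ≠ 2 * a) (h2 : 2 * c ≠ -(2 * a))
    (h5 : 2 * c ≠ 4 * a) (h7 : 2 * c ≠ -(4 * a)) :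
    PreservesDiff φ {c, -c} ∧ PreservesDiff φ {5 * a} := by
  have hw' := odd_mul_ne_zero hw hw2
  have h4a : 4 * a ≠ 0 := fun h => h2a (by linear_combination h10 - 2 * h)
  have h6a : 6 * a ≠ 0 := fun h => h4a (by linear_combination h10 - h)
  have h8a : 8 * a ≠ 0 := fun h => h2a (by linear_combination h10 - h)
  have h6c : 2 * c ≠ 6 * a := fun h => h7 (by linear_combination h + h10)
  have h6c' : 2 * c ≠ -(6 * a) := fun h => h5 (by linear_combination h - h10)
  have h18a : 18 * a ≠ 0 := fun h => h8a (by linear_combination h - h10)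
  have h24a : 24 * a ≠ 0 := fun h => h4a (by linear_combination h - 2 * h10)
  have ha : repCount T T (2 * a) = 3 := h.repCount_two_mul_left hw hw2 hwc h6a h8a h1 h2 h5 h7
  -- As 9a = −a, the set has the same shape with 3a in place of a.
  have hb : repCount T T (2 * (3 * a)) = 3 := by
    have h' : IsSextuple T (3 * a) (3 * (3 * a)) c := by
      rw [show 3 * (3 * a) = -a by linear_combination h10]
      exact h.swap_left.neg_mid
    exact h'.repCount_two_mul_left hw hw2 (by grind) (by grind) (by grind)
      (fun e => h7 (by linear_combination e + h10)) (fun e => h5 (by linear_combination e - h10))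
      (fun e => h1 (by linear_combination e + h10)) (fun e => h2 (by linear_combination e - h10))
  have hc : repCount T T (2 * c) ≤ 2 := repCount_le_two (b := c) (c := -c) <| by
    intro s
    rw [h, h]
    rintro (rfl | rfl | rfl | rfl | rfl | rfl) (e | e | e | e | e | e) <;> grind
  -- The doubles 2a and 6a = −4a share the count 3, so only the union of the two pairs is obtained.
  have hO : PreservesDiff φ {2 * a, -(2 * a), 4 * a, -(4 * a)} := by
    refine hT.of_repCount hT (· = 3) fun z => ?_
    have ha' := repCount_neg h.neg_mem h.neg_mem (2 * a)
    have hb' := repCount_neg h.neg_mem h.neg_mem (2 * (3 * a))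
    have hc' := repCount_neg h.neg_mem h.neg_mem (2 * c)
    constructor
    · simp only [Finset.mem_insert, Finset.mem_singleton]
      rintro (rfl | rfl | rfl | rfl)
      · exact ha
      · exact ha'.trans ha
      · rw [show 4 * a = -(2 * (3 * a)) by linear_combination h10]; exact hb'.trans hb
      · rw [show -(4 * a) = 2 * (3 * a) by linear_combination -h10]; exact hb
    · intro hz
      obtain ⟨s, hs, rfl⟩ := exists_two_mul_eq_of_odd (hz ▸ by decide : Odd (repCount T T z))
      simp only [Finset.mem_insert, Finset.mem_singleton]
      rw [← mul_neg] at hc'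
      rcases (h s).1 hs with rfl | rfl | rfl | rfl | rfl | rfl
      · simp
      · right; left; ring
      · right; right; right; linear_combination h10
      · right; right; left; linear_combination -h10
      all_goals omega
  have hcard : ({2 * a, -(2 * a), 4 * a, -(4 * a)} : Finset G).card = 4 := by
    rw [Finset.card_insert_of_notMem, Finset.card_eq_three.2
      ⟨-(2 * a), 4 * a, -(4 * a), by grind, by grind, by grind, rfl⟩]
    simp only [Finset.mem_insert, Finset.mem_singleton]
    grind
  have hneg : ∀ u ∈ ({2 * a, -(2 * a), 4 * a, -(4 * a)} : Finset G),
      -u ∈ ({2 * a, -(2 * a), 4 * a, -(4 * a)} : Finset G) := by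
    simp
  constructor
  · have n1 : a - 2 * a ∈ T := (h _).2 (by grind)
    have n2 : 3 * a - 2 * a ∈ T := (h _).2 (by grind)
    refine h.swap_right.swap_left.preservesDiff_left hT hO hneg (· = 0)
      (repCount_eq_zero ?_) (repCount_ne_zero_of_mem (by simp) n1)
      (repCount_ne_zero_of_mem (by simp) n2)
    simp only [Finset.mem_insert, Finset.mem_singleton]
    rintro u (rfl | rfl | rfl | rfl) <;> rw [h] <;> rintro (e | e | e | e | e | e) <;> grind
  -- 5a − {±2a, ±4a} = {±a, ±3a}, and 5a is the only z for which all four differences lie in T.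
  · refine hO.of_repCount hT (· = 4) fun z => ?_
    rw [Finset.mem_singleton]
    constructor
    · rintro rfl
      refine (repCount_eq_card ?_).trans hcard
      simp only [Finset.mem_insert, Finset.mem_singleton]
      rintro u (rfl | rfl | rfl | rfl) <;> rw [h] <;> grind
    · intro hz
      have key := forall_mem_of_repCount_eq_card (hz.trans hcard.symm)
      have k1 := (h _).1 (key (2 * a) (by simp))
      have k2 := (h _).1 (key (-(2 * a)) (by simp))
      have k3 := (h _).1 (key (4 * a) (by simp))
      have k4 := (h _).1 (key (-(4 * a)) (by simp))
      clear key hz hneg hcard hO h hT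
      rcases k1 with k1 | k1 | k1 | k1 | k1 | k1
      · rcases k4 with e | e | e | e | e | e <;> grind
      · rcases k3 with e | e | e | e | e | e <;> grind
      · grind
      · rcases k3 with e | e | e | e | e | e <;> grind
      · rcases k2 with e | e | e | e | e | e <;> grind
      · rcases k2 with e | e | e | e | e | e <;> grind

end IsSextuple

end DecagonConnectionSets

/-! ### The case 2c = a + b, and the generic case. -/

section MidpointConnectionSets

variable {G : Type*} [CommRing G] [DecidableEq G]
variable {φ : Equiv.Perm G} {T : Finset G} {a b c w : G}

theorem repCount_le_three {u : G} (h : ∀ s ∈ T, u - s ∈ T → s = a ∨ s = b ∨ s = c) :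
    repCount T T u ≤ 3 :=
  (Finset.card_le_card (t := {a, b, c}) fun s hs => by
    simpa using h s (Finset.mem_filter.1 hs).1 (Finset.mem_filter.1 hs).2).trans
    Finset.card_le_three

namespace IsSextuple

theorem repCount_two_mul_le_three (h : IsSextuple T a b c) (hw : w ≠ 0)
    (hw2 : 2 * w = 0) (hwb : w * b = w * a) (hwc : w * c = w * a + w)
    (h2a : 2 * a ≠ 0) (h2b : 2 * b ≠ 0)
    (h1 : 2 * a ≠ 2 * b) (h2 : 2 * a ≠ -(2 * b)) (h3 : 2 * a ≠ 2 * c) (h4 : 2 * a ≠ -(2 * c)) :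
    repCount T T (2 * a) ≤ 3 := by
  have hw' := odd_mul_ne_zero hw hw2
  by_cases hb : b = 3 * a
  · refine repCount_le_three (a := a) (b := -a) (c := b) fun s => ?_
    rw [h, h]
    rintro (rfl | rfl | rfl | rfl | rfl | rfl) (e | e | e | e | e | e) <;> grind
  · refine repCount_le_three (a := a) (b := -a) (c := -b) fun s => ?_
    rw [h, h]
    rintro (rfl | rfl | rfl | rfl | rfl | rfl) (e | e | e | e | e | e) <;> grind

theorem repCount_sub_le_three (h : IsSextuple T a b c) (hw : w ≠ 0)
    (hw2 : 2 * w = 0) (hwb : w * b = w * a) (hwc : w * c = w * a + w)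
    (h2a : 2 * a ≠ 0) (h2b : 2 * b ≠ 0)
    (h1 : 2 * a ≠ 2 * b) (h2 : 2 * a ≠ -(2 * b)) (h3 : 2 * c ≠ a - b) (h4 : 2 * c ≠ b - a) :
    repCount T T (a - b) ≤ 3 := by
  have hw' := odd_mul_ne_zero hw hw2
  by_cases hb : b = 3 * a
  · refine repCount_le_three (a := a) (b := -a) (c := -b) fun s => ?_
    rw [h, h]
    rintro (rfl | rfl | rfl | rfl | rfl | rfl) (e | e | e | e | e | e) <;> grind
  · refine repCount_le_three (a := a) (b := b) (c := -b) fun s => ?_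
    rw [h, h]
    rintro (rfl | rfl | rfl | rfl | rfl | rfl) (e | e | e | e | e | e) <;> grind

theorem repCount_add_right_eq_two (h : IsSextuple T a b c) (hw : w ≠ 0)
    (hw2 : 2 * w = 0) (hwb : w * b = w * a) (hwc : w * c = w * a + w)
    (h2a : 2 * a ≠ 0) (h2c : 2 * c ≠ 0)
    (h3 : 2 * a ≠ 2 * c) (h4 : 2 * a ≠ -(2 * c)) (h5 : 2 * c ≠ b - a) (h6 : 2 * c ≠ -(a + b)) :
    repCount T T (a + c) = 2 := by
  have hw' := odd_mul_ne_zero hw hw2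
  refine repCount_eq_two (b := a) (c := c) (by grind) fun s => ?_
  rw [h, h]
  constructor
  · rintro ⟨rfl | rfl | rfl | rfl | rfl | rfl, e | e | e | e | e | e⟩ <;> grind
  · rintro (rfl | rfl) <;> grind

/-- Here c − a = b − c has the four ordered representations c + (−a), b + (−c) and their swaps. Up
to sign the other sums of two elements are 0, with count 6, and 2a, 2b, 2c, a − b, a + c, b + c,
with counts at most 3. -/
theorem repCount_eq_four_iff (h : IsSextuple T a b c) (hcard : T.card = 6) (hw : w ≠ 0)
    (hw2 : 2 * w = 0) (hwb : w * b = w * a) (hwc : w * c = w * a + w) (hmid : 2 * c = a + b)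
    (h2a : 2 * a ≠ 0) (h2b : 2 * b ≠ 0) (h2c : 2 * c ≠ 0)
    (h1 : 2 * a ≠ 2 * b) (h2 : 2 * a ≠ -(2 * b)) (h3 : 2 * a ≠ 2 * c) (h4 : 2 * a ≠ -(2 * c))
    (h5 : 2 * b ≠ 2 * c) (h6 : 2 * b ≠ -(2 * c)) (z : G) :
    repCount T T z = 4 ↔ z = c - a ∨ z = -(c - a) := by
  have hw' := odd_mul_ne_zero hw hw2
  constructor
  · intro hz
    have key : ∀ y, repCount T T y ≠ 4 → z ≠ y ∧ z ≠ -y := by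
      refine fun y hy => ⟨?_, ?_⟩
      · rintro rfl; exact hy hz
      · rintro rfl; rw [repCount_neg h.neg_mem h.neg_mem] at hz; exact hy hz
    have k0 := (key 0 (by
      rw [repCount_eq_card (by simpa using h.neg_mem), hcard]; decide)).1
    have k1 := key (2 * a) (Nat.ne_of_lt (Nat.lt_succ_of_le
      (h.repCount_two_mul_le_three hw hw2 hwb hwc h2a h2b h1 h2 h3 h4)))
    have k2 := key (2 * b) (Nat.ne_of_lt (Nat.lt_succ_of_le
      (h.swap_left.repCount_two_mul_le_three hw hw2 hwb.symm (hwb ▸ hwc) h2b h2a h1.symm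
        (by grind) h5 h6)))
    have k3 := key (2 * c) (Nat.ne_of_lt (Nat.lt_succ_of_le (by
      refine repCount_le_three (a := a) (b := b) (c := c) fun s => ?_
      rw [h, h]
      rintro (rfl | rfl | rfl | rfl | rfl | rfl) (e | e | e | e | e | e) <;> grind)))
    have k4 := key (a - b) (Nat.ne_of_lt (Nat.lt_succ_of_le
      (h.repCount_sub_le_three hw hw2 hwb hwc h2a h2b h1 h2 (by grind) (by grind))))
    have k5 := key (a + c) (by
      rw [h.repCount_add_right_eq_two hw hw2 hwb hwc h2a h2c h3 h4 (by grind) (by grind)]; decide)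
    have k6 := key (b + c) (by
      rw [h.swap_left.repCount_add_right_eq_two hw hw2 hwb.symm (hwb ▸ hwc) h2b h2c h5 h6
        (by grind) (by grind)]; decide)
    obtain ⟨s, hs, hs'⟩ := exists_of_repCount_ne_zero (by rw [hz]; decide : repCount T T z ≠ 0)
    rw [h] at hs hs'
    clear hz key h
    rcases hs with rfl | rfl | rfl | rfl | rfl | rfl <;>
      rcases hs' with e | e | e | e | e | e <;> grind
  · have hd : repCount T T (c - a) = 4 := by
      have : ({s ∈ T | c - a - s ∈ T} : Finset G) = {c, -a, b, -c} := by
        ext s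
        simp only [Finset.mem_filter, Finset.mem_insert, Finset.mem_singleton]
        rw [h, h]
        constructor
        · rintro ⟨rfl | rfl | rfl | rfl | rfl | rfl, e | e | e | e | e | e⟩ <;> grind
        · rintro (rfl | rfl | rfl | rfl) <;> grind
      rw [repCount, this, Finset.card_insert_of_notMem, Finset.card_eq_three.2
        ⟨-a, b, -c, by grind, by grind, by grind, rfl⟩]
      simp only [Finset.mem_insert, Finset.mem_singleton]
      grind
    rintro (rfl | rfl)
    exacts [hd, (repCount_neg h.neg_mem h.neg_mem _).trans hd]

/-- The connection set `{±a, ±b, ±c}` with `2c = a + b`. -/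
theorem parallel_of_midpoint (h : IsSextuple T a b c) (hT : PreservesDiff φ T)
    (hcard : T.card = 6) (hw : w ≠ 0)
    (hw2 : 2 * w = 0) (hwb : w * b = w * a) (hwc : w * c = w * a + w) (hmid : 2 * c = a + b)
    (h2a : 2 * a ≠ 0) (h2b : 2 * b ≠ 0) (h2c : 2 * c ≠ 0)
    (h1 : 2 * a ≠ 2 * b) (h2 : 2 * a ≠ -(2 * b)) (h3 : 2 * a ≠ 2 * c) (h4 : 2 * a ≠ -(2 * c))
    (h5 : 2 * b ≠ 2 * c) (h6 : 2 * b ≠ -(2 * c)) :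
    ∀ s ∈ T, ∀ t ∈ T, Parallel φ s t := by
  have hw' := odd_mul_ne_zero hw hw2
  have hd : PreservesDiff φ {c - a, -(c - a)} := hT.of_repCount hT (· = 4) fun z => by
    rw [h.repCount_eq_four_iff hcard hw hw2 hwb hwc hmid h2a h2b h2c h1 h2 h3 h4 h5 h6,
      Finset.mem_insert, Finset.mem_singleton]
  have hne : c - a ≠ -(c - a) := by grind
  -- With d = c − a the elements a, c, b form the progression c − d, c, c + d; only its middle term
  -- has both d-neighbours in T.
  have n1 : a - (c - a) ∉ T := by
    rw [h]; rintro (e | e | e | e | e | e) <;> grind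
  have n2 : b + (c - a) ∉ T := by
    rw [h]; rintro (e | e | e | e | e | e) <;> grind
  have n3 : c - (c - a) ∈ T := (h _).2 (by grind)
  have n4 : c + (c - a) ∈ T := (h _).2 (by grind)
  have hU : ∀ u ∈ ({c - a, -(c - a)} : Finset G), -u ∈ ({c - a, -(c - a)} : Finset G) := by
    simp only [Finset.mem_insert, Finset.mem_singleton]
    rintro u (rfl | rfl) <;> simp
  have pc : PreservesDiff φ {c, -c} := by
    refine h.swap_right.swap_left.preservesDiff_left hT hd hU (· = 2) ?_ ?_ ?_ <;>
      rw [repCount_pair hne]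
    · rw [if_pos n3, if_pos n4]
    · rw [if_neg n1]; split_ifs <;> decide
    · rw [if_neg n2]; split_ifs <;> decide
  -- The directions c and d are both preserved and generate a = c − d and b = c + d.
  have hcd := pc.parallel hd (by grind) (by grind)
  have e1 : c ∈ AddSubgroup.closure {c, c - a} := AddSubgroup.subset_closure (by simp)
  have e2 : c - a ∈ AddSubgroup.closure {c, c - a} := AddSubgroup.subset_closure (by simp)
  refine h.parallel (X := {c, c - a}) ?_ (by simpa using sub_mem e1 e2) ?_ e1
  · rintro s (rfl | rfl) t (rfl | rfl)
    exacts [pc.parallel_self, hcd, hcd.symm, hd.parallel_self]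
  · convert add_mem e1 e2 using 1
    linear_combination -hmid

theorem repCount_two_mul_left_eq_one (h : IsSextuple T a b c) (hw : w ≠ 0)
    (hw2 : 2 * w = 0) (hwb : w * b = w * a) (hwc : w * c = w * a + w)
    (h2a : 2 * a ≠ 0) (h2b : 2 * b ≠ 0)
    (h1 : 2 * a ≠ 2 * b) (h2 : 2 * a ≠ -(2 * b)) (h3 : 2 * a ≠ 2 * c) (h4 : 2 * a ≠ -(2 * c))
    (hba : b ≠ 3 * a) (hba' : b ≠ -(3 * a)) (h4a : 4 * a ≠ 0) : repCount T T (2 * a) = 1 := by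
  have hw' := odd_mul_ne_zero hw hw2
  refine repCount_eq_one (b := a) fun s => ?_
  rw [h, h]
  constructor
  · rintro ⟨rfl | rfl | rfl | rfl | rfl | rfl, e | e | e | e | e | e⟩ <;> grind
  · rintro rfl; grind

theorem repCount_two_mul_right_eq_one (h : IsSextuple T a b c) (hw : w ≠ 0)
    (hw2 : 2 * w = 0) (hwb : w * b = w * a) (hwc : w * c = w * a + w) (h2c : 2 * c ≠ 0)
    (h3 : 2 * a ≠ 2 * c) (h4 : 2 * a ≠ -(2 * c)) (h5 : 2 * b ≠ 2 * c) (h6 : 2 * b ≠ -(2 * c))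
    (hc1 : 2 * c ≠ a + b) (hc2 : 2 * c ≠ -(a + b)) (hc3 : 2 * c ≠ a - b) (hc4 : 2 * c ≠ b - a)
    (h4c : 4 * c ≠ 0) : repCount T T (2 * c) = 1 := by
  have hw' := odd_mul_ne_zero hw hw2
  refine repCount_eq_one (b := c) fun s => ?_
  rw [h, h]
  constructor
  · rintro ⟨rfl | rfl | rfl | rfl | rfl | rfl, e | e | e | e | e | e⟩ <;> grind
  · rintro rfl; grind

theorem repCount_add_left_eq_two (h : IsSextuple T a b c) (hw : w ≠ 0)
    (hw2 : 2 * w = 0) (hwb : w * b = w * a) (hwc : w * c = w * a + w)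
    (h2a : 2 * a ≠ 0) (h2b : 2 * b ≠ 0) (h1 : 2 * a ≠ 2 * b) (h2 : 2 * a ≠ -(2 * b))
    (hba' : b ≠ -(3 * a)) (hab' : a ≠ -(3 * b)) (hc1 : 2 * c ≠ a + b) (hc2 : 2 * c ≠ -(a + b)) :
    repCount T T (a + b) = 2 := by
  have hw' := odd_mul_ne_zero hw hw2
  refine repCount_eq_two (b := a) (c := b) (by grind) fun s => ?_
  rw [h, h]
  constructor
  · rintro ⟨rfl | rfl | rfl | rfl | rfl | rfl, e | e | e | e | e | e⟩ <;> grind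
  · rintro (rfl | rfl) <;> grind

/-- The connection set `{±a, ±b, ±c}` without nondegenerate coincidences between sums of two
elements, apart from those caused by elements of order four. -/
theorem parallel_of_generic (h : IsSextuple T a b c) (hT : PreservesDiff φ T) (hw : w ≠ 0)
    (hw2 : 2 * w = 0) (hwb : w * b = w * a) (hwc : w * c = w * a + w)
    (h2a : 2 * a ≠ 0) (h2b : 2 * b ≠ 0) (h2c : 2 * c ≠ 0)
    (h1 : 2 * a ≠ 2 * b) (h2 : 2 * a ≠ -(2 * b)) (h3 : 2 * a ≠ 2 * c) (h4 : 2 * a ≠ -(2 * c))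
    (h5 : 2 * b ≠ 2 * c) (h6 : 2 * b ≠ -(2 * c))
    (hba : b ≠ 3 * a) (hba' : b ≠ -(3 * a)) (hab : a ≠ 3 * b) (hab' : a ≠ -(3 * b))
    (hc1 : 2 * c ≠ a + b) (hc2 : 2 * c ≠ -(a + b)) (hc3 : 2 * c ≠ a - b) (hc4 : 2 * c ≠ b - a)
    (hquad : ∀ x y : G, 4 * x = 0 → 4 * y = 0 → 2 * x ≠ 0 → 2 * y ≠ 0 → 2 * x = 2 * y) :
    ∀ s ∈ T, ∀ t ∈ T, Parallel φ s t := by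
  have hw' := odd_mul_ne_zero hw hw2
  have ra := h.repCount_two_mul_left_eq_one hw hw2 hwb hwc h2a h2b h1 h2 h3 h4 hba hba'
  have rb := h.swap_left.repCount_two_mul_left_eq_one hw hw2 hwb.symm (hwb ▸ hwc) h2b h2a h1.symm
    (by grind) h5 h6 hab hab'
  have rc := h.repCount_two_mul_right_eq_one hw hw2 hwb hwc h2c h3 h4 h5 h6 hc1 hc2 hc3 hc4
  have rab := h.repCount_add_left_eq_two hw hw2 hwb hwc h2a h2b h1 h2 hba' hab' hc1 hc2
  have rac := h.repCount_add_right_eq_two hw hw2 hwb hwc h2a h2c h3 h4 hc4 hc2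
  have rbc := h.swap_left.repCount_add_right_eq_two hw hw2 hwb.symm (hwb ▸ hwc) h2b h2c h5 h6 hc3
    (by rwa [add_comm])
  have hnz : ∀ s ∈ T, 2 * s ≠ 0 := by
    intro s hs
    rcases (h s).1 hs with rfl | rfl | rfl | rfl | rfl | rfl <;> simpa
  have hdbl : ∀ s ∈ T, ∀ t ∈ T, 2 * s = 2 * t → s = t ∨ s = -t := by
    clear ra rb rc rab rac rbc hba hba' hab hab' hc1 hc2 hc3 hc4 hT hquad hw hw2 hwb hwc hw' hnz
    intro s hs t ht
    rw [h] at hs ht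
    rcases hs with rfl | rfl | rfl | rfl | rfl | rfl <;>
      rcases ht with rfl | rfl | rfl | rfl | rfl | rfl <;>
      intro e <;>
      first | (left; rfl) | (right; rfl) | (right; rw [neg_neg]; done) | grind
  have key := hT.parallel_of_repCount h.neg_mem
    (by
      intro s hs
      rcases (h s).1 hs with rfl | rfl | rfl | rfl | rfl | rfl <;> grind)
    (by
      intro s hs h4s
      have hneg : ∀ y, repCount T T (2 * y) = 1 → repCount T T (2 * -y) = 1 := fun y hy => by
        rw [mul_neg, repCount_neg h.neg_mem h.neg_mem, hy]
      rcases (h s).1 hs with rfl | rfl | rfl | rfl | rfl | rfl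
      · exact ra h4s
      · exact hneg _ (ra (by grind))
      · exact rb h4s
      · exact hneg _ (rb (by grind))
      · exact rc h4s
      · exact hneg _ (rc (by grind)))
    (fun s hs t ht hs4 ht4 => hdbl s hs t ht (hquad s t hs4 ht4 (hnz s hs) (hnz t ht)))
  exact h.parallel_of_pairwise (key.1 a h.left_mem) (key.1 b h.mid_mem) (key.1 c h.right_mem)
    (key.2 a h.left_mem b h.mid_mem (fun e => h1 (by rw [e])) (fun e => h2 (by rw [e]; ring)) rab)
    (key.2 a h.left_mem c h.right_mem (fun e => h3 (by rw [e])) (fun e => h4 (by rw [e]; ring)) rac)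
    (key.2 b h.mid_mem c h.right_mem (fun e => h5 (by rw [e])) (fun e => h6 (by rw [e]; ring)) rbc)

end IsSextuple

end MidpointConnectionSets

/-! ### Connection sets {±a, ±(a + v), ±c} with 2v = 0. -/

section InvolutionConnectionSets

variable {G : Type*} [CommRing G] [DecidableEq G]
variable {φ : Equiv.Perm G} {T : Finset G} {a b c v : G}

theorem PreservesDiff.singleton_zero (φ : Equiv.Perm G) : PreservesDiff φ {0} := fun x y => by
  simp [sub_eq_zero]

namespace IsSextuple

/-- The double 2a = 2(a + v) arises from two elements, so its count is even, and ±2c are the only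
elements with odd count. -/
theorem preservesDiff_two_mul (h : IsSextuple T a (a + v) c) (hT : PreservesDiff φ T)
    (hv : v ≠ 0) (hv2 : 2 * v = 0) (h4a : 4 * a ≠ 0) (h4c : 4 * c ≠ 0)
    (h1 : 2 * a ≠ 2 * c) (h2 : 2 * a ≠ -(2 * c)) : PreservesDiff φ {2 * c, -(2 * c)} := by
  refine hT.of_repCount hT Odd fun z => ?_
  have hc : Odd (repCount T T (2 * c)) := by
    have : ({s ∈ T | 2 * s = 2 * c} : Finset G) = {c} := by
      ext s
      rw [Finset.mem_filter, Finset.mem_singleton, h]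
      constructor
      · rintro ⟨rfl | rfl | rfl | rfl | rfl | rfl, e⟩ <;> grind
      · rintro rfl; grind
    rw [← ZMod.natCast_eq_one_iff_odd, repCount_self_mod_two, this, Finset.card_singleton,
      Nat.cast_one]
  have ha : ¬ Odd (repCount T T (2 * a)) := by
    have : ({s ∈ T | 2 * s = 2 * a} : Finset G) = {a, a + v} := by
      ext s
      rw [Finset.mem_filter, Finset.mem_insert, Finset.mem_singleton, h]
      constructor
      · rintro ⟨rfl | rfl | rfl | rfl | rfl | rfl, e⟩ <;> grind
      · rintro (rfl | rfl) <;> grind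
    rw [← ZMod.natCast_eq_one_iff_odd, repCount_self_mod_two, this, Finset.card_pair (by grind)]
    decide
  have ha' : ¬ Odd (repCount T T (-(2 * a))) := by rwa [repCount_neg h.neg_mem h.neg_mem]
  rw [Finset.mem_insert, Finset.mem_singleton]
  constructor
  · rintro (rfl | rfl)
    · exact hc
    · rwa [repCount_neg h.neg_mem h.neg_mem]
  · intro hz
    obtain ⟨s, hs, rfl⟩ := exists_two_mul_eq_of_odd hz
    rcases (h s).1 hs with rfl | rfl | rfl | rfl | rfl | rfl
    · exact absurd hz ha
    · rw [mul_neg] at hz; exact absurd hz ha'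
    · rw [mul_add, hv2, add_zero] at hz; exact absurd hz ha
    · rw [mul_neg, mul_add, hv2, add_zero] at hz; exact absurd hz ha'
    · simp
    · simp

/-- Steps by ±2c single out ±c: one such step leads from c to −c, and from a or a + v a step stays
in T only towards c or −c, that is, when the element is ±3c. In that case c has two such steps and
the others at most one; otherwise the counts are 1, 0, 0. -/
theorem preservesDiff_right (h : IsSextuple T a (a + v) c) (hT : PreservesDiff φ T)
    (hv : v ≠ 0) (hv2 : 2 * v = 0) (h4a : 4 * a ≠ 0) (h4c : 4 * c ≠ 0)
    (h1 : 2 * a ≠ 2 * c) (h2 : 2 * a ≠ -(2 * c)) (h3 : 2 * a ≠ 2 * c + v)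
    (h4 : 2 * a ≠ -(2 * c) + v) : PreservesDiff φ {c, -c} := by
  have h2c := h.preservesDiff_two_mul hT hv hv2 h4a h4c h1 h2
  have hne : 2 * c ≠ -(2 * c) := by grind
  have hU : ∀ u ∈ ({2 * c, -(2 * c)} : Finset G), -u ∈ ({2 * c, -(2 * c)} : Finset G) := by simp
  have n1 : c - 2 * c ∈ T := (h _).2 (by grind)
  have a1 : a - 2 * c ∈ T → a = 3 * c := by
    rw [h]; rintro (e | e | e | e | e | e) <;> grind
  have a2 : a + 2 * c ∈ T → a = -(3 * c) := by
    rw [h]; rintro (e | e | e | e | e | e) <;> grind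
  have b1 : a + v - 2 * c ∈ T → a + v = 3 * c := by
    rw [h]; rintro (e | e | e | e | e | e) <;> grind
  have b2 : a + v + 2 * c ∈ T → a + v = -(3 * c) := by
    rw [h]; rintro (e | e | e | e | e | e) <;> grind
  by_cases n2 : c + 2 * c ∈ T
  · refine h.swap_right.swap_left.preservesDiff_left hT h2c hU (· = 2) ?_ ?_ ?_ <;>
      rw [repCount_pair hne]
    · rw [if_pos n1, if_pos n2]
    · have : ¬ (a - 2 * c ∈ T ∧ a + 2 * c ∈ T) := by
        rintro ⟨e1, e2⟩
        have := a1 e1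
        have := a2 e2
        clear n1 n2 hU h2c h hT a1 a2 b1 b2 e1 e2
        grind
      split_ifs <;> simp_all
    · have : ¬ (a + v - 2 * c ∈ T ∧ a + v + 2 * c ∈ T) := by
        rintro ⟨e1, e2⟩
        have := b1 e1
        have := b2 e2
        clear n1 n2 hU h2c h hT a1 a2 b1 b2 e1 e2
        grind
      split_ifs <;> simp_all
  · have hmem : ∀ x ∈ T, x ≠ 3 * c ∧ x ≠ -(3 * c) := by
      refine fun x hx => ⟨?_, ?_⟩
      · rintro rfl; exact n2 (by convert hx using 1; ring)
      · rintro rfl; exact n2 (by convert h.neg_mem _ hx using 1; ring)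
    have ha := hmem a h.left_mem
    have hb := hmem (a + v) h.mid_mem
    refine h.swap_right.swap_left.preservesDiff_left hT h2c hU (· = 1) ?_ ?_ ?_ <;>
      rw [repCount_pair hne]
    · rw [if_pos n1, if_neg n2]
    · rw [if_neg fun e => ha.1 (a1 e), if_neg fun e => ha.2 (a2 e)]; decide
    · rw [if_neg fun e => hb.1 (b1 e), if_neg fun e => hb.2 (b2 e)]; decide

/-- Once ±c is removed, {±a, ±(a + v)} is left, whose translation stabiliser is exactly {0, v}
because 4a is neither 0 nor v. -/
theorem preservesDiff_involution (h : IsSextuple T a (a + v) c) (hT : PreservesDiff φ T)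
    (hc : PreservesDiff φ {c, -c}) (hv : v ≠ 0) (hv2 : 2 * v = 0) (h4a : 4 * a ≠ 0)
    (h4a' : 4 * a ≠ v) (h1 : 2 * a ≠ 2 * c) (h2 : 2 * a ≠ -(2 * c)) :
    PreservesDiff φ {v} := by
  have hA : ∀ x, x ∈ T \ {c, -c} ↔ x = a ∨ x = -a ∨ x = a + v ∨ x = -(a + v) := by
    intro x
    rw [Finset.mem_sdiff, h, Finset.mem_insert, Finset.mem_singleton]
    constructor
    · tauto
    · rintro (rfl | rfl | rfl | rfl) <;> grind
  have hA' := hT.sdiff hc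
  have h0v : PreservesDiff φ {0, v} := by
    refine hA'.of_repCount hA' (· = (T \ {c, -c}).card) fun z => ?_
    rw [Finset.mem_insert, Finset.mem_singleton]
    constructor
    · intro hz
      refine repCount_eq_card fun u => ?_
      rw [hA, hA]
      clear hA hA' h hT hc
      rintro (rfl | rfl | rfl | rfl) <;> rcases hz with rfl | rfl <;> grind
    · intro hz
      have key := forall_mem_of_repCount_eq_card hz
      have k1 := (hA _).1 (key a ((hA _).2 (by simp)))
      have k2 := (hA _).1 (key (-a) ((hA _).2 (by simp)))
      clear key hA hA' h hT hc hz
      rcases k1 with e | e | e | e <;> rcases k2 with e' | e' | e' | e' <;> grind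
  have : ({0, v} \ {0} : Finset G) = {v} := by
    ext x
    simp only [Finset.mem_sdiff, Finset.mem_insert, Finset.mem_singleton]
    grind
  exact this ▸ h0v.sdiff (.singleton_zero φ)

end IsSextuple

/-- The connection set `{±u} + {q, 2q, 3q}` on the side `t` of the double cover, where `4q = 0`. -/
theorem PreservesDiff.singleton_of_tensor {u q t : G} (hT : PreservesDiff φ T)
    (hu : PreservesDiff φ {u, -u})
    (hmem : ∀ x, x ∈ T ↔ x = t + q + u ∨ x = t + q - u ∨ x = t + 2 * q + u ∨ x = t + 2 * q - u ∨
      x = t + 3 * q + u ∨ x = t + 3 * q - u)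
    (h2t : 2 * t = 0) (h4q : 4 * q = 0) (h2q : 2 * q ≠ 0) (h16u : 16 * u ≠ 0) :
    PreservesDiff φ {t} := by
  have hne : u ≠ -u := fun e => h16u (by linear_combination 8 * e)
  have h3q : 3 * q ≠ 0 := fun e => h2q (by linear_combination 2 * e - h4q)
  have h5q : 5 * q ≠ 0 := fun e => h2q (by linear_combination 2 * e - 2 * h4q)
  have h5q' : 5 * q = q := by linear_combination h4q
  have h6q' : 6 * q = 2 * q := by linear_combination h4q
  have h8u : 8 * u ≠ 0 := fun e => h16u (by linear_combination 2 * e)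
  -- These are the midpoints z with both z + u and z − u in T.
  have hW : PreservesDiff φ {t + q, t + 2 * q, t + 3 * q} := by
    refine hu.of_repCount hT (· = 2) fun z => ?_
    rw [repCount_pair hne]
    simp only [Finset.mem_insert, Finset.mem_singleton]
    constructor
    · intro hz
      rw [if_pos, if_pos] <;> rw [hmem] <;> clear hmem hT hu <;> rcases hz with rfl | rfl | rfl <;>
        grind
    · intro hz
      have : z - u ∈ T ∧ z + u ∈ T := by split_ifs at hz <;> simp_all
      obtain ⟨e1, e2⟩ := this
      rw [hmem] at e1 e2
      clear hmem hT hu hz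
      rcases e1 with e1 | e1 | e1 | e1 | e1 | e1 <;>
        rcases e2 with e2 | e2 | e2 | e2 | e2 | e2 <;> grind
  have hcardW : ({t + q, t + 2 * q, t + 3 * q} : Finset G).card = 3 :=
    Finset.card_eq_three.2 ⟨t + q, t + 2 * q, t + 3 * q, by grind, by grind, by grind, rfl⟩
  have hcardV : ({q, 2 * q, 3 * q} : Finset G).card = 3 :=
    Finset.card_eq_three.2 ⟨q, 2 * q, 3 * q, by grind, by grind, by grind, rfl⟩
  -- As 2t = 0 and 4q = 0, in W + W the element 0 has count 3 and q, 2q, 3q have count 2.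
  have hV : PreservesDiff φ {q, 2 * q, 3 * q} := by
    refine hW.of_repCount hW (· = 2) fun z => ?_
    constructor
    · intro hz
      have key : ∀ x y : G, x ≠ y → (∀ s, (s = t + q ∨ s = t + 2 * q ∨ s = t + 3 * q) ∧
          (z - s = t + q ∨ z - s = t + 2 * q ∨ z - s = t + 3 * q) ↔ s = x ∨ s = y) →
          repCount {t + q, t + 2 * q, t + 3 * q} {t + q, t + 2 * q, t + 3 * q} z = 2 :=
        fun x y hxy hs => repCount_eq_two (b := x) (c := y) hxy fun s => by
          simpa only [Finset.mem_insert, Finset.mem_singleton] using hs s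
      simp only [Finset.mem_insert, Finset.mem_singleton] at hz
      clear hT hu hmem hW hcardV hcardW
      rcases hz with rfl | rfl | rfl
      · refine key (t + 2 * z) (t + 3 * z) (by grind) fun s => ⟨?_, ?_⟩
        · rintro ⟨rfl | rfl | rfl, e | e | e⟩ <;> grind
        · rintro (rfl | rfl) <;> grind
      · refine key (t + q) (t + 3 * q) (by grind) fun s => ⟨?_, ?_⟩
        · rintro ⟨rfl | rfl | rfl, e | e | e⟩ <;> grind
        · rintro (rfl | rfl) <;> grind
      · refine key (t + q) (t + 2 * q) (by grind) fun s => ⟨?_, ?_⟩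
        · rintro ⟨rfl | rfl | rfl, e | e | e⟩ <;> grind
        · rintro (rfl | rfl) <;> grind
    · intro hz
      have hz0 : z ≠ 0 := by
        rintro rfl
        rw [repCount_eq_card, hcardW] at hz
        · omega
        · simp only [Finset.mem_insert, Finset.mem_singleton]
          clear hT hu hmem hW hcardV hcardW hz
          rintro s (rfl | rfl | rfl) <;> grind
      obtain ⟨s, hs, hs'⟩ := exists_of_repCount_ne_zero (by rw [hz]; decide)
      simp only [Finset.mem_insert, Finset.mem_singleton] at hs hs' ⊢
      clear hT hu hmem hW hcardV hcardW hz
      rcases hs with rfl | rfl | rfl <;> rcases hs' with e | e | e <;>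
        first
          | exact absurd (by linear_combination e + h2t + h4q) hz0
          | exact absurd (by linear_combination e + h2t) hz0
          | exact absurd (by linear_combination e) hz0
          | exact .inl (by linear_combination e)
          | exact .inl (by linear_combination e + h2t)
          | exact .inl (by linear_combination e + h2t + h4q)
          | exact .inl (by linear_combination e + h2t - h4q)
          | exact .inr (.inl (by linear_combination e + h2t))
          | exact .inr (.inl (by linear_combination e + h2t + h4q))
          | exact .inr (.inl (by linear_combination e + h2t - h4q))
          | exact .inr (.inr (by linear_combination e + h2t))
  -- The element t is the only z with z − {q, 2q, 3q} contained in t + {q, 2q, 3q}.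
  refine hV.of_repCount hW (· = 3) fun z => ?_
  rw [Finset.mem_singleton]
  constructor
  · rintro rfl
    rw [repCount_eq_card, hcardV]
    simp only [Finset.mem_insert, Finset.mem_singleton]
    clear hT hu hmem hW hV hcardV hcardW
    rintro s (rfl | rfl | rfl) <;> grind
  · intro hz
    have key := forall_mem_of_repCount_eq_card (hz.trans hcardV.symm)
    have k1 := key q (by simp)
    have k2 := key (2 * q) (by simp)
    have k3 := key (3 * q) (by simp)
    simp only [Finset.mem_insert, Finset.mem_singleton] at k1 k2 k3
    clear hT hu hmem hW hV hcardV hcardW key hz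
    rcases k1 with e | e | e
    · rcases k2 with e' | e' | e' <;> grind
    · rcases k3 with e' | e' | e' <;> grind
    · grind

end InvolutionConnectionSets

/-! ### The double cover as a Cayley graph of ℤ_n × ℤ₂. -/

section CirculantDoubleCover

open SimpleGraph

/-- The connection set of the canonical double cover of a Cayley graph, as a Cayley graph of
`ZMod n × ZMod 2`. -/
def coverSet {n : ℕ} (S : Finset (ZMod n)) : Finset (ZMod n × ZMod 2) := S ×ˢ {1}

theorem mem_coverSet {n : ℕ} {S : Finset (ZMod n)} {x : ZMod n × ZMod 2} :
    x ∈ coverSet S ↔ x.1 ∈ S ∧ x.2 = 1 := by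
  rcases x with ⟨x, i⟩
  simpa [coverSet] using fun _ => eq_comm

variable {n : ℕ} [NeZero n] {S : Finset (ZMod n)}

theorem addCayley_adj_iff (hzero : (0 : ZMod n) ∉ S) (hneg : ∀ s ∈ S, -s ∈ S) (u v : ZMod n) :
    (addCayley (S : Set (ZMod n))).Adj u v ↔ v - u ∈ S := by
  rw [addCayley_adj']
  constructor
  · rintro ⟨-, g, hg, h | h⟩
    · rw [← h, add_sub_cancel_left]; exact hg
    · rw [h, sub_add_cancel_left]; exact hneg g hg
  · intro h
    refine ⟨?_, v - u, h, Or.inl (by ring)⟩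
    rintro rfl
    rw [sub_self] at h
    exact hzero h

theorem closure_eq_top_of_connected (hzero : (0 : ZMod n) ∉ S) (hneg : ∀ s ∈ S, -s ∈ S)
    (hconn : (addCayley (S : Set (ZMod n))).Connected) :
    AddSubgroup.closure (S : Set (ZMod n)) = ⊤ := by
  have key : ∀ u v, (addCayley (S : Set (ZMod n))).Walk u v →
      v - u ∈ AddSubgroup.closure (S : Set (ZMod n)) := by
    intro u v p
    induction p with
    | nil => rw [sub_self]; exact zero_mem _
    | cons h p ih =>
      have := add_mem ih (AddSubgroup.subset_closure ((addCayley_adj_iff hzero hneg _ _).1 h))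
      rwa [sub_add_sub_cancel] at this
  rw [eq_top_iff]
  intro v _
  obtain ⟨p⟩ := hconn.preconnected 0 v
  simpa using key 0 v p

/-- By connectedness K projects onto ℤ_n. If it missed (0,1), it would contain exactly one point
over each x, and the second coordinate of that point would be a proper 2-colouring. -/
theorem closure_coverSet (hzero : (0 : ZMod n) ∉ S) (hneg : ∀ s ∈ S, -s ∈ S)
    (hconn : (addCayley (S : Set (ZMod n))).Connected)
    (hbip : ¬ (addCayley (S : Set (ZMod n))).IsBipartite) :
    AddSubgroup.closure (coverSet S : Set (ZMod n × ZMod 2)) = ⊤ := by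
  set K := AddSubgroup.closure (coverSet S : Set (ZMod n × ZMod 2)) with hK
  have hmem : ∀ s ∈ S, (s, 1) ∈ K := fun s hs =>
    AddSubgroup.subset_closure (by simp [mem_coverSet, hs])
  have hproj : ∀ x : ZMod n, ∃ i, (x, i) ∈ K := by
    intro x
    have hx : x ∈ AddSubgroup.closure (S : Set (ZMod n)) := by
      rw [closure_eq_top_of_connected hzero hneg hconn]; trivial
    have hle : AddSubgroup.closure (S : Set (ZMod n)) ≤ K.map (AddMonoidHom.fst _ _) :=
      (AddSubgroup.closure_le _).2 fun s hs => ⟨(s, 1), hmem s hs, rfl⟩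
    obtain ⟨⟨y, i⟩, hy, rfl⟩ := hle hx
    exact ⟨i, hy⟩
  have hflip : ((0, 1) : ZMod n × ZMod 2) ∈ K := by
    by_contra hflip
    refine hbip ?_
    have hcol : ∀ u v, (addCayley (S : Set (ZMod n))).Adj u v →
        ¬ (((u, 0) ∈ K) ↔ ((v, 0) ∈ K)) := by
      intro u v huv
      have huv := hmem _ ((addCayley_adj_iff hzero hneg u v).1 huv)
      have hor : ∀ x : ZMod n, (x, 0) ∉ K → (x, 1) ∈ K := fun x hx => by
        obtain ⟨i, hi⟩ := hproj x
        fin_cases i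
        · exact absurd hi hx
        · exact hi
      have h1 : ¬ ((u, 0) ∈ K ∧ (v, 0) ∈ K) := fun ⟨hu, hv⟩ => hflip <| by
        simpa using sub_mem huv (sub_mem hv hu)
      have h2 : ¬ ((u, 1) ∈ K ∧ (v, 1) ∈ K) := fun ⟨hu, hv⟩ => hflip <| by
        simpa using sub_mem huv (sub_mem hv hu)
      have := hor u
      have := hor v
      tauto
    classical
    exact (Coloring.mk (fun x => decide ((x, (0 : ZMod 2)) ∈ K)) fun {u v} huv e =>
      hcol u v huv (by simpa using e) : (addCayley (S : Set (ZMod n))).Coloring Bool).colorable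
  rw [eq_top_iff]
  rintro ⟨x, i⟩ -
  obtain ⟨j, hj⟩ := hproj x
  by_cases hij : i = j
  · rwa [hij]
  · have : i = j + 1 := (by decide : ∀ i j : ZMod 2, i ≠ j → i = j + 1) i j hij
    simpa [this] using add_mem hj hflip

/-- A step in the connection set and its image both change the second coordinate by 1, and these
steps generate the group. -/
theorem snd_apply_add {φ : Equiv.Perm (ZMod n × ZMod 2)} (hφ : PreservesDiff φ (coverSet S))
    (htop : AddSubgroup.closure (coverSet S : Set (ZMod n × ZMod 2)) = ⊤)
    (x y : ZMod n × ZMod 2) : (φ (x + y)).2 = (φ x).2 + y.2 := by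
  have hy : y ∈ AddSubgroup.closure (coverSet S : Set (ZMod n × ZMod 2)) := htop ▸ trivial
  induction hy using AddSubgroup.closure_induction generalizing x with
  | mem y hy =>
    have h1 := (mem_coverSet.1 (hφ.apply_add_mem hy x)).2
    have h2 := (mem_coverSet.1 hy).2
    rw [Prod.snd_sub] at h1
    linear_combination h1 - h2
  | zero => simp
  | add y z _ _ hy hz => rw [← add_assoc, hz, hy, Prod.snd_add, add_assoc]
  | neg y _ hy =>
    have := hy (x + -y)
    rw [neg_add_cancel_right] at this
    rw [this, Prod.snd_neg, add_neg_cancel_right]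

/-- The vertices of the double cover as elements of `ZMod n × ZMod 2`. -/
def coverEquiv (n : ℕ) : ZMod n ⊕ ZMod n ≃ ZMod n × ZMod 2 where
  toFun := Sum.elim (fun v => (v, 0)) (fun v => (v, 1))
  invFun x := if x.2 = 0 then Sum.inl x.1 else Sum.inr x.1
  left_inv := by rintro (v | v) <;> simp
  right_inv := by
    rintro ⟨v, i⟩
    rcases (by decide : ∀ i : ZMod 2, i = 0 ∨ i = 1) i with rfl | rfl <;> simp

theorem bipartiteDoubleCover_adj_iff (hzero : (0 : ZMod n) ∉ S) (hneg : ∀ s ∈ S, -s ∈ S)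
    (p q : ZMod n ⊕ ZMod n) : (addCayley (S : Set (ZMod n))).bipartiteDoubleCover.Adj p q ↔
      coverEquiv n q - coverEquiv n p ∈ coverSet S := by
  rcases p with p | p <;> rcases q with q | q <;>
    simp [coverEquiv, mem_coverSet, addCayley_adj_iff hzero hneg]

/-- An unstable circulant graph has an automorphism of its double cover that fixes one vertex and
moves the other vertex of the same fibre. -/
theorem IsUnstableGraph.exists_perm (hzero : (0 : ZMod n) ∉ S) (hneg : ∀ s ∈ S, -s ∈ S)
    (htop : AddSubgroup.closure (coverSet S : Set (ZMod n × ZMod 2)) = ⊤)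
    (hunst : IsUnstableGraph (addCayley (S : Set (ZMod n)))) :
    ∃ φ : Equiv.Perm (ZMod n × ZMod 2), PreservesDiff φ (coverSet S) ∧ φ 0 = 0 ∧
      φ (0, 1) ≠ (0, 1) := by
  -- If every normalised automorphism fixes (0,1), then conjugating by translations shows that ψ
  -- commutes with the exchange of the two points of every fibre, so it descends to an automorphism
  -- α of the graph.
  by_contra! hfix
  obtain ⟨ψ, hψ⟩ := hunst
  set Ψ : Equiv.Perm (ZMod n × ZMod 2) :=
    ((coverEquiv n).symm.trans ψ.toEquiv).trans (coverEquiv n) with hΨ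
  have happ : ∀ p, Ψ (coverEquiv n p) = coverEquiv n (ψ p) := fun p => by simp [hΨ]
  have hpres : PreservesDiff Ψ (coverSet S) := by
    intro x y
    obtain ⟨p, rfl⟩ := (coverEquiv n).surjective x
    obtain ⟨q, rfl⟩ := (coverEquiv n).surjective y
    rw [happ, happ, ← bipartiteDoubleCover_adj_iff hzero hneg,
      ← bipartiteDoubleCover_adj_iff hzero hneg]
    exact ψ.map_rel_iff
  have hflip : ∀ x, Ψ (x + (0, 1)) = Ψ x + (0, 1) := by
    intro x
    have := hfix (((Equiv.addLeft x).trans Ψ).trans (Equiv.subRight (Ψ x))) (fun y z => by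
      simpa using hpres (x + y) (x + z)) (by simp)
    simp only [Equiv.trans_apply, Equiv.coe_addLeft, Equiv.subRight_apply] at this
    exact (sub_eq_iff_eq_add'.1 this)
  have hsnd : ∀ v : ZMod n, (Ψ (v, 0)).2 = (Ψ 0).2 := fun v => by
    have := snd_apply_add hpres htop 0 (v, 0)
    rwa [zero_add, add_zero] at this
  have hinj : Function.Injective fun v : ZMod n => (Ψ (v, 0)).1 := fun v w h => by
    have := Ψ.injective (Prod.ext h ((hsnd v).trans (hsnd w).symm))
    exact congrArg Prod.fst this
  have h1 : ∀ v : ZMod n, Ψ (v, 1) = Ψ (v, 0) + (0, 1) := fun v => by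
    rw [← hflip]; simp
  let α : addCayley (S : Set (ZMod n)) ≃g addCayley (S : Set (ZMod n)) :=
    { toEquiv := Equiv.ofBijective _ (Finite.injective_iff_bijective.1 hinj)
      map_rel_iff' := by
        intro v w
        have := hpres (v, 0) (w, 1)
        rw [h1, mem_coverSet, mem_coverSet] at this
        simpa [addCayley_adj_iff hzero hneg, hsnd] using this }
  have hα : ∀ v, α v = (Ψ (v, 0)).1 := fun _ => rfl
  have hl : ∀ v, ψ (Sum.inl v) = (coverEquiv n).symm (α v, (Ψ 0).2) := fun v => by
    rw [Equiv.eq_symm_apply, ← happ]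
    exact Prod.ext rfl (hsnd v)
  have hr : ∀ v, ψ (Sum.inr v) = (coverEquiv n).symm (α v, (Ψ 0).2 + 1) := fun v => by
    rw [Equiv.eq_symm_apply, ← happ]
    refine (h1 v).trans (Prod.ext ?_ ?_)
    · rw [Prod.fst_add, hα, add_zero]
    · rw [Prod.snd_add, hsnd]
  have h2 : (1 : ZMod 2) + 1 = 0 := by decide
  refine hψ ⟨α, ?_⟩
  generalize (Ψ 0).2 = i at hl hr
  rcases (by decide : ∀ i : ZMod 2, i = 0 ∨ i = 1) i with rfl | rfl
  · left
    funext p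
    rcases p with v | v
    · rw [hl]; simp [coverEquiv]
    · rw [hr]; simp [coverEquiv]
  · right
    funext p
    rcases p with v | v
    · rw [hl]; simp [coverEquiv]
    · rw [hr]; simp [coverEquiv, h2]

end CirculantDoubleCover

/-! ### Case analysis when 2a, 2b, 2c differ up to sign. -/

section DistinctDoubles

variable {G : Type*} [CommRing G] [DecidableEq G]
variable {φ : Equiv.Perm G} {T : Finset G} {a b c w : G}

namespace IsSextuple

theorem parallel_or_of_eq_three_mul (h : IsSextuple T a b c) (hT : PreservesDiff φ T)
    (hw : w ≠ 0) (hw2 : 2 * w = 0) (hwc : w * c = w * a + w) (hba : b = 3 * a)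
    (h2a : 2 * a ≠ 0) (h2b : 2 * b ≠ 0) (h2c : 2 * c ≠ 0)
    (h2 : 2 * a ≠ -(2 * b)) (h3 : 2 * a ≠ 2 * c) (h4 : 2 * a ≠ -(2 * c))
    (h5 : 2 * b ≠ 2 * c) (h6 : 2 * b ≠ -(2 * c)) (hc1 : 2 * c ≠ a + b) (hc2 : 2 * c ≠ -(a + b)) :
    (∀ s ∈ T, ∀ t ∈ T, Parallel φ s t) ∨ ∃ a' c', 10 * a' = 0 ∧ w * c' = w * a' + w ∧
      a' ∈ T ∧ c' ∈ T ∧ PreservesDiff φ {c', -c'} ∧ PreservesDiff φ {5 * a'} := by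
  subst hba
  have k1 : 2 * c ≠ 4 * a := fun e => hc1 (by linear_combination e)
  have k2 : 2 * c ≠ -(4 * a) := fun e => hc2 (by linear_combination e)
  by_cases h10 : 10 * a = 0
  · obtain ⟨hc, h5a⟩ := h.preservesDiff_of_ten_mul_eq_zero hT hw hw2 hwc h2a h10 h2c h3.symm
      (fun e => h4 (by linear_combination e)) k1 k2
    exact .inr ⟨a, c, h10, hwc, h.left_mem, h.right_mem, hc, h5a⟩
  · exact .inl (h.parallel_of_eq_three_mul hT hw hw2 hwc
      (fun e => h2b (by linear_combination e)) (fun e => h2 (by linear_combination e)) h10 h2c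
      h3.symm (fun e => h4 (by linear_combination e)) (fun e => h5 (by linear_combination -e))
      (fun e => h6 (by linear_combination e)) k1 k2)

/-- If `±2a`, `±2b`, `±2c` are distinct, then `φ` is affine on the subgroup generated by
`T = {±a, ±b, ±c}`, except possibly in the presence of a decagon. -/
theorem parallel_or_of_two_mul_ne (h : IsSextuple T a b c) (hT : PreservesDiff φ T)
    (hcard : T.card = 6) (hw : w ≠ 0) (hw2 : 2 * w = 0) (hwb : w * b = w * a)
    (hwc : w * c = w * a + w) (h2a : 2 * a ≠ 0) (h2b : 2 * b ≠ 0) (h2c : 2 * c ≠ 0)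
    (h1 : 2 * a ≠ 2 * b) (h2 : 2 * a ≠ -(2 * b)) (h3 : 2 * a ≠ 2 * c) (h4 : 2 * a ≠ -(2 * c))
    (h5 : 2 * b ≠ 2 * c) (h6 : 2 * b ≠ -(2 * c))
    (hquad : ∀ x y : G, 4 * x = 0 → 4 * y = 0 → 2 * x ≠ 0 → 2 * y ≠ 0 → 2 * x = 2 * y) :
    (∀ s ∈ T, ∀ t ∈ T, Parallel φ s t) ∨ ∃ a' c', 10 * a' = 0 ∧ w * c' = w * a' + w ∧
      a' ∈ T ∧ c' ∈ T ∧ PreservesDiff φ {c', -c'} ∧ PreservesDiff φ {5 * a'} := by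
  have n1 : 2 * -a ≠ 0 := fun e => h2a (by linear_combination -e)
  have n2 : 2 * -b ≠ 0 := fun e => h2b (by linear_combination -e)
  have n3 : 2 * -c ≠ 0 := fun e => h2c (by linear_combination -e)
  -- These are the nondegenerate coincidences that parity permits; changing signs of generators and
  -- exchanging a, b reduces them to 2c = a + b and b = 3a.
  by_cases hc1 : 2 * c = a + b
  · exact .inl (h.parallel_of_midpoint hT hcard hw hw2 hwb hwc hc1 h2a h2b h2c h1 h2 h3 h4 h5 h6)
  by_cases hc2 : 2 * c = -(a + b)
  · exact .inl (h.neg_right.parallel_of_midpoint hT hcard hw hw2 hwb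
      (by linear_combination -hwc - (a + 1) * hw2)
      (by linear_combination -hc2) h2a h2b n3 h1 h2 (fun e => h4 (by linear_combination e))
      (fun e => h3 (by linear_combination e)) (fun e => h6 (by linear_combination e))
      (fun e => h5 (by linear_combination e)))
  by_cases hc3 : 2 * c = a - b
  · exact .inl (h.neg_mid.parallel_of_midpoint hT hcard hw hw2
      (by linear_combination -hwb - a * hw2) hwc
      (by linear_combination hc3) h2a n2 h2c (fun e => h2 (by linear_combination e))
      (fun e => h1 (by linear_combination e)) h3 h4 (fun e => h6 (by linear_combination -e))
      (fun e => h5 (by linear_combination -e)))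
  by_cases hc4 : 2 * c = b - a
  · exact .inl (h.neg_left.parallel_of_midpoint hT hcard hw hw2
      (by linear_combination hwb + a * hw2) (by linear_combination hwc + a * hw2)
      (by linear_combination hc4) n1 h2b h2c (fun e => h2 (by linear_combination -e))
      (fun e => h1 (by linear_combination -e)) (fun e => h4 (by linear_combination -e))
      (fun e => h3 (by linear_combination -e)) h5 h6)
  by_cases hba : b = 3 * a
  · exact h.parallel_or_of_eq_three_mul hT hw hw2 hwc hba h2a h2b h2c h2 h3 h4 h5 h6 hc1 hc2
  by_cases hba' : b = -(3 * a)
  · exact h.neg_mid.parallel_or_of_eq_three_mul hT hw hw2 hwc (by linear_combination -hba')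
      h2a n2 h2c (fun e => h1 (by linear_combination e)) h3 h4
      (fun e => h6 (by linear_combination -e)) (fun e => h5 (by linear_combination -e))
      (fun e => hc3 (by linear_combination e)) (fun e => hc4 (by linear_combination e))
  by_cases hab : a = 3 * b
  · exact h.swap_left.parallel_or_of_eq_three_mul hT hw hw2 (by linear_combination hwc - hwb) hab
      h2b h2a h2c (fun e => h2 (by linear_combination e)) h5 h6 h3 h4
      (fun e => hc1 (by linear_combination e)) (fun e => hc2 (by linear_combination e))
  by_cases hab' : a = -(3 * b)
  · exact h.neg_left.swap_left.parallel_or_of_eq_three_mul hT hw hw2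
      (by linear_combination hwc - hwb) (by linear_combination -hab')
      h2b n1 h2c (fun e => h1 (by linear_combination -e)) h5 h6
      (fun e => h4 (by linear_combination -e)) (fun e => h3 (by linear_combination -e))
      (fun e => hc4 (by linear_combination e)) (fun e => hc3 (by linear_combination e))
  exact .inl (h.parallel_of_generic hT hw hw2 hwb hwc h2a h2b h2c h1 h2 h3 h4 h5 h6 hba hba' hab
    hab' hc1 hc2 hc3 hc4 hquad)

end IsSextuple

end DistinctDoubles

/-! ### The element n/2 and parity. -/

section HalfModulus

/-- The class of `n / 2`; for even `n`, the element of order two of `ZMod n`. -/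
def ZMod.half (n : ℕ) : ZMod n := ((n / 2 : ℕ) : ZMod n)

namespace ZMod

variable {n : ℕ} [NeZero n]

theorem two_mul_half (hn : Even n) : 2 * half n = 0 := by
  have : ((2 * (n / 2) : ℕ) : ZMod n) = 0 := by
    rw [Nat.two_mul_div_two_of_even hn, natCast_self]
  simpa [half] using this

theorem half_ne_zero (hn : Even n) : half n ≠ 0 := by
  rw [half, Ne, natCast_eq_zero_iff]
  intro h
  have h0 := NeZero.pos n
  obtain ⟨k, rfl⟩ := hn
  have := Nat.le_of_dvd (by omega) h
  omega

theorem two_mul_eq_zero_iff (hn : Even n) (x : ZMod n) : 2 * x = 0 ↔ x = 0 ∨ x = half n := by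
  constructor
  · intro h
    have hx := natCast_zmod_val x
    have hlt := val_lt x
    rw [← hx] at h
    have h' : ((2 * x.val : ℕ) : ZMod n) = 0 := by simpa using h
    rw [natCast_eq_zero_iff] at h'
    obtain ⟨k, hk⟩ := h'
    have hk2 : k < 2 := by
      by_contra hk2
      have := Nat.mul_le_mul_left n (not_lt.1 hk2)
      omega
    interval_cases k
    · left
      rw [← hx, show x.val = 0 by omega, Nat.cast_zero]
    · right
      rw [← hx, half, show x.val = n / 2 by omega]
  · rintro (rfl | rfl)
    · exact mul_zero 2
    · exact two_mul_half hn

/-- Multiplication by n/2 is the parity character for even n: value 0 on even classes, n/2 on odd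
ones. -/
theorem half_mul (hn : Even n) (x : ZMod n) : half n * x = 0 ∨ half n * x = half n := by
  rw [← two_mul_eq_zero_iff hn, ← mul_assoc, two_mul_half hn, zero_mul]

theorem half_mul_two_mul (hn : Even n) (x : ZMod n) : half n * (2 * x) = 0 := by
  linear_combination x * two_mul_half hn

theorem half_mul_eq_zero_iff (hn : Even n) (x : ZMod n) : half n * x = 0 ↔ ∃ y, x = 2 * y := by
  constructor
  · intro h
    rw [half, ← natCast_zmod_val x, ← Nat.cast_mul, natCast_eq_zero_iff] at h
    have h0 := NeZero.pos n
    have : 2 ∣ x.val := by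
      obtain ⟨k, hk⟩ := h
      obtain ⟨m, rfl⟩ := hn
      refine ⟨k, ?_⟩
      rw [show (m + m) / 2 = m by omega] at hk
      refine Nat.eq_of_mul_eq_mul_left (show 0 < m by omega) (hk.trans ?_)
      ring
    obtain ⟨k, hk⟩ := this
    exact ⟨k, by rw [← natCast_zmod_val x, hk]; push_cast; rfl⟩
  · rintro ⟨y, rfl⟩
    exact half_mul_two_mul hn y

theorem half_mul_half (hn : Even n) (h2 : Even (n / 2)) : half n * half n = 0 := by
  obtain ⟨k, hk⟩ := h2
  rw [half_mul_eq_zero_iff hn]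
  exact ⟨k, by rw [half, hk]; push_cast; ring⟩

theorem half_mul_half_of_odd (hn : Even n) (h2 : Odd (n / 2)) : half n * half n = half n := by
  obtain ⟨k, hk⟩ := h2
  have : half n = 2 * k + 1 := by rw [half, hk]; push_cast; ring
  linear_combination half n * this + k * two_mul_half hn

theorem mem_zmultiples_iff {g x : ZMod n} : x ∈ AddSubgroup.zmultiples g ↔ ∃ y, x = y * g := by
  rw [AddSubgroup.mem_zmultiples_iff]
  constructor
  · rintro ⟨k, rfl⟩
    exact ⟨k, by simp⟩
  · rintro ⟨y, rfl⟩
    exact ⟨y.val, by simp⟩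

end ZMod

end HalfModulus

/-- When doubling is injective on U, each double has exactly one root in U, so the doubles are the
elements with odd count. -/
theorem PreservesDiff.image_two_mul {G : Type*} [CommRing G] [DecidableEq G] {φ : Equiv.Perm G}
    {U : Finset G} (hU : PreservesDiff φ U) (hinj : Set.InjOn (fun x : G => 2 * x) U) :
    PreservesDiff φ (U.image fun x => 2 * x) := by
  refine hU.of_repCount hU Odd fun z => ?_
  constructor
  · intro hz
    obtain ⟨s, hs, rfl⟩ := Finset.mem_image.1 hz
    have : ({t ∈ U | 2 * t = 2 * s} : Finset G) = {s} := by
      ext t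
      rw [Finset.mem_filter, Finset.mem_singleton]
      exact ⟨fun ⟨ht, e⟩ => hinj ht hs e, by rintro rfl; exact ⟨hs, rfl⟩⟩
    rw [← ZMod.natCast_eq_one_iff_odd, repCount_self_mod_two, this, Finset.card_singleton,
      Nat.cast_one]
  · intro hz
    obtain ⟨s, hs, rfl⟩ := exists_two_mul_eq_of_odd hz
    exact Finset.mem_image_of_mem _ hs

/-! ### Additive automorphisms give C.4; odd n gives stability. -/

section CirculantAutomorphisms

variable {n : ℕ} [NeZero n] {S : Finset (ZMod n)} {φ : Equiv.Perm (ZMod n × ZMod 2)}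

/-- An automorphism of the double cover that is additive gives Wilson's condition C.4. -/
theorem wilsonC4_of_parallel (hn : Even n) (hφ : PreservesDiff φ (coverSet S))
    (htop : AddSubgroup.closure (coverSet S : Set (ZMod n × ZMod 2)) = ⊤) (h0 : φ 0 = 0)
    (hτ : φ (0, 1) ≠ (0, 1))
    (hpar : ∀ s ∈ coverSet S, ∀ t ∈ coverSet S, Parallel φ s t) : WilsonC4 S := by
  have hadd : ∀ x y, φ (x + y) = φ x + φ y := fun x y => by
    have := Parallel.of_closure (X := (coverSet S : Set (ZMod n × ZMod 2))) hpar
      (s := x) (t := y) (htop ▸ trivial) (htop ▸ trivial) 0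
    rw [zero_add, zero_add, h0] at this
    linear_combination this
  have hsnd : ∀ x, (φ x).2 = x.2 := fun x => by
    simpa [h0] using snd_apply_add hφ htop 0 x
  set m := (φ (1, 0)).1 with hm
  have hmul : ∀ x : ZMod n, φ (x, 0) = (m * x, 0) := by
    have : ∀ k : ℕ, φ ((k : ZMod n), 0) = (m * k, 0) := by
      intro k
      induction k with
      | zero => rw [Nat.cast_zero, mul_zero]; exact h0
      | succ k ih =>
        rw [show (((k + 1 : ℕ) : ZMod n), (0 : ZMod 2)) = ((k : ZMod n), 0) + (1, 0) by simp, hadd,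
          ih, Prod.ext_iff]
        refine ⟨?_, ?_⟩
        · rw [Prod.fst_add, ← hm]; push_cast; ring
        · rw [Prod.snd_add, hsnd, add_zero]
    intro x
    simpa using this x.val
  -- By additivity φ(0,1) is killed by 2, so its first coordinate is 0 or n/2, and 0 is excluded by
  -- `hτ`.
  have hflip : φ (0, 1) = (ZMod.half n, 1) := by
    have h2 := hadd (0, 1) (0, 1)
    rw [show ((0, 1) : ZMod n × ZMod 2) + (0, 1) = 0 from Prod.ext (add_zero 0) (show (1 : ZMod 2) + 1 = 0 by decide),
      h0] at h2
    have h3 : 2 * (φ (0, 1)).1 = 0 := by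
      rw [two_mul, ← Prod.fst_add, ← h2, Prod.fst_zero]
    refine Prod.ext ?_ (hsnd _)
    refine ((ZMod.two_mul_eq_zero_iff hn _).1 h3).resolve_left fun h => hτ ?_
    exact Prod.ext h (hsnd _)
  have hinj : Function.Injective fun x : ZMod n => m * x := fun x y e => by
    have : φ (x, 0) = φ (y, 0) := by rw [hmul, hmul]; exact congrArg (·, 0) e
    exact congrArg Prod.fst (φ.injective this)
  obtain ⟨k, hk⟩ := (Finite.injective_iff_surjective.1 hinj) 1
  have hk' : m * k = 1 := hk
  refine ⟨hn, Units.mkOfMulEqOne m k hk', ?_⟩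
  refine Finset.eq_of_subset_of_card_le ?_ ?_
  · intro x hx
    obtain ⟨s, hs, rfl⟩ := Finset.mem_image.1 hx
    have := hφ.apply_add_mem (mem_coverSet.2 ⟨hs, rfl⟩ : (s, 1) ∈ coverSet S) 0
    rw [show (0 : ZMod n × ZMod 2) + (s, 1) = (s, 0) + (0, 1) by simp, hadd, h0, hmul, hflip,
      mem_coverSet] at this
    have := this.1
    rwa [sub_zero, Prod.fst_add, add_comm] at this
  · rw [Finset.card_image_of_injective]
    intro x y e
    exact hinj (add_left_cancel e)

/-- Doubling is injective on ℤ_n for odd n and kills ℤ₂. Iterating it `n.totient` times returns S in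
the first coordinate and 0 in the second, so S × {0} is preserved too. Thus (0,0) and (0,1), hence
also their images, are related to the layer ℤ_n × {1} through the same set S, and twin-freeness
makes the first coordinates of the images equal. -/
theorem apply_flip_of_odd (hn : Odd n) (hφ : PreservesDiff φ (coverSet S))
    (htop : AddSubgroup.closure (coverSet S : Set (ZMod n × ZMod 2)) = ⊤) (h0 : φ 0 = 0)
    (htwin : ∀ y, (∀ s, s ∈ S ↔ s - y ∈ S) → y = 0) : φ (0, 1) = (0, 1) := by
  have hsnd : ∀ x, (φ x).2 = x.2 := fun x => by
    simpa [h0] using snd_apply_add hφ htop 0 x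
  have hpow : ∀ j : ℕ,
      PreservesDiff φ (S.image (fun x => 2 ^ j * x) ×ˢ {(2 : ZMod 2) ^ j}) := by
    intro j
    induction j with
    | zero => simpa [coverSet] using hφ
    | succ j ih =>
      have := ih.image_two_mul ?_
      · convert this using 1
        ext ⟨x, i⟩
        simp only [Finset.mem_product, Finset.mem_image, Finset.mem_singleton, Prod.exists,
          Prod.ext_iff, pow_succ']
        constructor
        · rintro ⟨⟨s, hs, rfl⟩, rfl⟩
          exact ⟨2 ^ j * s, 2 ^ j, ⟨⟨s, hs, rfl⟩, rfl⟩, (mul_assoc _ _ _).symm, rfl⟩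
        · rintro ⟨_, _, ⟨⟨s, hs, rfl⟩, rfl⟩, rfl, rfl⟩
          exact ⟨⟨s, hs, mul_assoc _ _ _⟩, rfl⟩
      · rintro ⟨x, i⟩ hx ⟨y, i'⟩ hy e
        simp only [Finset.coe_product, Set.mem_prod, Finset.coe_singleton,
          Set.mem_singleton_iff] at hx hy
        refine Prod.ext ?_ (hx.2.trans hy.2.symm)
        have e1 : 2 * x = 2 * y := congrArg Prod.fst e
        obtain ⟨k, hk⟩ := hn
        have h1 : (2 * k + 1 : ZMod n) = 0 := by
          have := congrArg (Nat.cast : ℕ → ZMod n) hk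
          rw [ZMod.natCast_self] at this
          push_cast at this
          exact this.symm
        show x = y
        linear_combination (x - y) * h1 - k * e1
  have hS : PreservesDiff φ (S ×ˢ {(0 : ZMod 2)}) := by
    have := hpow n.totient
    have h1 : (2 : ZMod n) ^ n.totient = 1 := by
      have := (ZMod.natCast_eq_natCast_iff _ _ _).2
        (Nat.ModEq.pow_totient (Nat.coprime_two_left.2 hn))
      simpa using this
    have h2 : (2 : ZMod 2) ^ n.totient = 0 := by
      rw [show (2 : ZMod 2) = 0 from rfl]
      exact zero_pow (Nat.totient_pos.2 (NeZero.pos n)).ne'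
    simpa [h1, h2] using this
  -- With (s,1) = φ(z,1), both s ∈ S and s − y ∈ S are equivalent to z ∈ S, where y is the first
  -- coordinate of φ(0,1).
  have key := htwin (φ (0, 1)).1 fun s => by
    obtain ⟨⟨z, i⟩, hz⟩ := φ.surjective (s, 1)
    have hi : i = 1 := by have := hsnd (z, i); rw [hz] at this; exact this.symm
    subst hi
    have e1 := hφ 0 (z, 1)
    have e2 := hS (0, 1) (z, 1)
    rw [hz, h0, mem_coverSet, mem_coverSet] at e1
    rw [hz, Finset.mem_product, Finset.mem_product, Finset.mem_singleton,
      Finset.mem_singleton] at e2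
    have e3 := hsnd (0, 1)
    simp only [sub_zero, Prod.fst_sub, Prod.snd_sub, e3, sub_self, and_true] at e1 e2
    exact e1.trans e2.symm
  exact Prod.ext key (hsnd _)

end CirculantAutomorphisms

/-! ### Nondegeneracy of a sextuple with six elements. -/

namespace IsSextuple

variable {G : Type*} [CommRing G] [DecidableEq G] {T : Finset G} {a b c : G}

theorem two_mul_left_ne_zero (h : IsSextuple T a b c) (hcard : T.card = 6) : 2 * a ≠ 0 := by
  intro e
  have hsub : T ⊆ {a, b, -b, c, -c} := fun x hx => by
    have : -a = a := by linear_combination -e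
    rw [h, this] at hx
    simp only [Finset.mem_insert, Finset.mem_singleton]
    tauto
  have := (Finset.card_le_card hsub).trans Finset.card_le_five
  omega

theorem left_ne_mid (h : IsSextuple T a b c) (hcard : T.card = 6) : a ≠ b := by
  rintro rfl
  have hsub : T ⊆ {a, -a, c, -c} := fun x hx => by
    rw [h] at hx
    simp only [Finset.mem_insert, Finset.mem_singleton]
    tauto
  have := (Finset.card_le_card hsub).trans Finset.card_le_four
  omega

end IsSextuple

/-! ### Circulant graphs of valency six, and C.4 for distinct doubles. -/

section CirculantConnectionSets

open SimpleGraph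

variable {n : ℕ} [NeZero n] {S : Finset (ZMod n)} {φ : Equiv.Perm (ZMod n × ZMod 2)}
variable {a b c : ZMod n}

theorem card_eq_of_isRegularOfDegree (hzero : (0 : ZMod n) ∉ S) (hneg : ∀ s ∈ S, -s ∈ S) {d : ℕ}
    (hval : (addCayley (S : Set (ZMod n))).IsRegularOfDegree d) : S.card = d := by
  rw [← hval 0, degree]
  congr 1
  ext x
  rw [mem_neighborFinset, addCayley_adj_iff hzero hneg, sub_zero]

theorem IsTwinFreeGraph.eq_zero (hzero : (0 : ZMod n) ∉ S) (hneg : ∀ s ∈ S, -s ∈ S)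
    (htwin : IsTwinFreeGraph (addCayley (S : Set (ZMod n)))) {y : ZMod n}
    (h : ∀ s, s ∈ S ↔ s - y ∈ S) : y = 0 := by
  refine (htwin 0 y ?_).symm
  ext x
  rw [mem_neighborSet, mem_neighborSet, addCayley_adj_iff hzero hneg,
    addCayley_adj_iff hzero hneg, sub_zero, h]

/-- If all elements of S were odd, parity would be a proper 2-colouring. -/
theorem exists_half_mul_eq_zero (hn : Even n) (hzero : (0 : ZMod n) ∉ S) (hneg : ∀ s ∈ S, -s ∈ S)
    (hbip : ¬ (addCayley (S : Set (ZMod n))).IsBipartite) : ∃ s ∈ S, ZMod.half n * s = 0 := by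
  by_contra! hS
  refine hbip ?_
  refine (Coloring.mk (fun x => decide (ZMod.half n * x = 0)) fun {u v} huv e => ?_ :
    (addCayley (S : Set (ZMod n))).Coloring Bool).colorable
  have huv := hS _ ((addCayley_adj_iff hzero hneg u v).1 huv)
  rw [decide_eq_decide] at e
  rcases ZMod.half_mul hn u with hu | hu <;> rcases ZMod.half_mul hn v with hv | hv
  · exact huv (by rw [mul_sub, hu, hv, sub_zero])
  · exact ZMod.half_ne_zero hn (hv ▸ e.1 hu)
  · exact ZMod.half_ne_zero hn (hu ▸ e.2 hv)
  · exact huv (by rw [mul_sub, hu, hv, sub_self])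

theorem exists_half_mul_eq_half (hn : Even n)
    (htop : AddSubgroup.closure (S : Set (ZMod n)) = ⊤) : ∃ s ∈ S, ZMod.half n * s = ZMod.half n := by
  by_contra! hS
  have hle : AddSubgroup.closure (S : Set (ZMod n)) ≤ (AddMonoidHom.mulLeft (ZMod.half n)).ker :=
    (AddSubgroup.closure_le _).2 fun s hs => (ZMod.half_mul hn s).resolve_right (hS s hs)
  have : ZMod.half n * 1 = 0 := hle (x := 1) (htop ▸ trivial)
  rw [mul_one] at this
  exact ZMod.half_ne_zero hn this

/-- For even `n`, a symmetric set of six nonzero elements of `ZMod n` does not contain the element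
of order two. -/
theorem exists_isSextuple (hn : Even n) (hzero : (0 : ZMod n) ∉ S) (hneg : ∀ s ∈ S, -s ∈ S)
    (hcard : S.card = 6) : ∃ a b c, IsSextuple S a b c := by
  have hne : ∀ s ∈ S, s ≠ ZMod.half n → s ≠ -s := fun s hs h1 e =>
    ((ZMod.two_mul_eq_zero_iff hn s).1 (by linear_combination e)).elim
      (fun h => hzero (h ▸ hs)) h1
  -- The sets to be avoided have at most 1, 3 and 5 elements, fewer than six, so n/2 can be excluded
  -- at each choice.
  obtain ⟨a, ha, ha'⟩ := Finset.exists_mem_notMem_of_card_lt_card (s := {ZMod.half n}) (t := S)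
    (by rw [Finset.card_singleton, hcard]; decide)
  obtain ⟨b, hb, hb'⟩ := Finset.exists_mem_notMem_of_card_lt_card (s := {ZMod.half n, a, -a})
    (t := S) (Finset.card_le_three.trans_lt (by rw [hcard]; decide))
  obtain ⟨c, hc, hc'⟩ := Finset.exists_mem_notMem_of_card_lt_card
    (s := {ZMod.half n, a, -a, b, -b}) (t := S)
    (Finset.card_le_five.trans_lt (by rw [hcard]; decide))
  simp only [Finset.mem_insert, Finset.mem_singleton, not_or] at ha' hb' hc'
  have h1 := hne a ha ha'
  have h2 := hne b hb hb'.1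
  have h3 := hne c hc hc'.1
  have heq : ({a, -a, b, -b, c, -c} : Finset (ZMod n)) = S := by
    refine Finset.eq_of_subset_of_card_le ?_ ?_
    · intro x hx
      simp only [Finset.mem_insert, Finset.mem_singleton] at hx
      rcases hx with rfl | rfl | rfl | rfl | rfl | rfl <;> first | assumption | exact hneg _ ‹_›
    · rw [hcard]
      refine le_of_eq (Eq.symm ?_)
      rw [Finset.card_insert_of_notMem, Finset.card_insert_of_notMem,
        Finset.card_insert_of_notMem, Finset.card_insert_of_notMem, Finset.card_pair h3]
      all_goals simp only [Finset.mem_insert, Finset.mem_singleton, not_or, neg_inj]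
      all_goals grind
  exact ⟨a, b, c, fun x => by rw [← heq]; simp only [Finset.mem_insert, Finset.mem_singleton]⟩

theorem IsSextuple.coverSet (h : IsSextuple S a b c) :
    IsSextuple (coverSet S) ((a, 1) : ZMod n × ZMod 2) (b, 1) (c, 1) := by
  rintro ⟨x, i⟩
  have h1 : -(1 : ZMod 2) = 1 := by decide
  rw [mem_coverSet, h]
  simp only [Prod.neg_mk, h1, Prod.mk.injEq]
  tauto

theorem card_coverSet : (coverSet S).card = S.card := by
  rw [_root_.coverSet, Finset.card_product, Finset.card_singleton, mul_one]

/-- Doubling kills ℤ₂ and n/2 is the only involution of ℤ_n, so both doubles are (n/2, 0). Hence T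
contains at most one pair of elements of order four when doubles are distinct up to sign. -/
theorem ZMod.two_mul_eq_of_four_mul_eq_zero (hn : Even n) {x y : ZMod n × ZMod 2}
    (hx : 4 * x = 0) (hy : 4 * y = 0) (hx2 : 2 * x ≠ 0) (hy2 : 2 * y ≠ 0) : 2 * x = 2 * y := by
  have key : ∀ x : ZMod n × ZMod 2, 4 * x = 0 → 2 * x ≠ 0 → 2 * x = (ZMod.half n, 0) := by
    intro x hx hx2
    have e2 : (2 * x).2 = 0 := by
      rw [Prod.snd_mul]
      exact (by decide : ∀ i : ZMod 2, 2 * i = 0) x.2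
    have e1 : 2 * (2 * x).1 = 0 := by
      have := congrArg Prod.fst hx
      rw [Prod.fst_mul] at this ⊢
      rw [Prod.fst_zero] at this
      have h4 : (4 : ZMod n × ZMod 2).1 = 2 * (2 : ZMod n × ZMod 2).1 := by
        show (4 : ZMod n) = 2 * 2
        norm_num
      rw [← mul_assoc, ← h4, this]
    refine Prod.ext ?_ e2
    exact ((ZMod.two_mul_eq_zero_iff hn _).1 e1).resolve_left fun h => hx2 (Prod.ext h e2)
  rw [key x hx hx2, key y hy hy2]

/-- If `n / 2` times a preserved direction is combined with a preserved element `(5x, 1)` of order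
two, the two vertices of each fibre cannot be separated. -/
theorem preservesDiff_flip_of_ten_mul_eq_zero (hn : Even n) {x y : ZMod n} (h10 : 10 * x = 0)
    (hxy : ZMod.half n * y = ZMod.half n * x + ZMod.half n)
    (hy : PreservesDiff φ {((y, 1) : ZMod n × ZMod 2), -(y, 1)})
    (hx : PreservesDiff φ {((5 * x, 1) : ZMod n × ZMod 2)}) :
    PreservesDiff φ {((0, 1) : ZMod n × ZMod 2)} := by
  -- The multiple (n/2)(y,1) of a preserved direction is killed by 2, so translation by it commutes
  -- with φ.
  have hk : PreservesDiff φ {((ZMod.half n * y, ((n / 2 : ℕ) : ZMod 2)) : ZMod n × ZMod 2)} := by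
    have := hy.mul_pair (n / 2)
    have e : ((n / 2 : ℕ) : ZMod n × ZMod 2) * (y, 1) =
        (ZMod.half n * y, ((n / 2 : ℕ) : ZMod 2)) := by
      refine Prod.ext ?_ ?_
      · rw [Prod.fst_mul, Prod.fst_natCast, ZMod.half]
      · rw [Prod.snd_mul, Prod.snd_natCast, mul_one]
    rw [e] at this
    refine this.singleton_of_two_mul_eq_zero (Prod.ext ?_ ?_)
    · show 2 * (ZMod.half n * y) = 0
      rw [← mul_assoc, ZMod.two_mul_half hn, zero_mul]
    · exact (by decide : ∀ i : ZMod 2, 2 * i = 0) _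
  have h2 := ZMod.two_mul_half hn
  rcases (ZMod.two_mul_eq_zero_iff hn (5 * x)).1 (by linear_combination h10) with h5 | h5
  · rwa [h5] at hx
  -- Now 5x = n/2, so x has the parity of n/2 and y the opposite one. For n/2 even, (n/2)(y,1) =
  -- (n/2, 0), which added to (5x,1) = (n/2, 1) gives (0,1); for n/2 odd, it is itself (0,1).
  · rcases Nat.even_or_odd (n / 2) with hpar | hpar
    · have hνν := ZMod.half_mul_half hn hpar
      have e1 : ZMod.half n * y = ZMod.half n := by
        linear_combination hxy - 2 * x * h2 + hνν + ZMod.half n * h5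
      rw [e1, (ZMod.natCast_eq_zero_iff_even).2 hpar] at hk
      rw [h5] at hx
      have := hx.add_singleton hk
      rwa [show ((ZMod.half n, 1) : ZMod n × ZMod 2) + (ZMod.half n, 0) = (0, 1) from
        Prod.ext (by rw [Prod.fst_add, ← two_mul, h2]) (add_zero 1)] at this
    · have hνν := ZMod.half_mul_half_of_odd hn hpar
      have e1 : ZMod.half n * y = 0 := by
        linear_combination hxy - 2 * x * h2 + hνν + ZMod.half n * h5 + h2
      rwa [e1, (ZMod.natCast_eq_one_iff_odd).2 hpar] at hk

/-- Wilson's condition C.4 holds if `±2a`, `±2b`, `±2c` are distinct. -/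
theorem wilsonC4_of_two_mul_ne (hn : Even n) (h : IsSextuple S a b c) (hcard : S.card = 6)
    (hφ : PreservesDiff φ (coverSet S))
    (htop : AddSubgroup.closure (coverSet S : Set (ZMod n × ZMod 2)) = ⊤) (h0 : φ 0 = 0)
    (hτ : φ (0, 1) ≠ (0, 1)) (hwb : ZMod.half n * b = ZMod.half n * a)
    (hwc : ZMod.half n * c = ZMod.half n * a + ZMod.half n)
    (h1 : 2 * a ≠ 2 * b) (h2 : 2 * a ≠ -(2 * b)) (h3 : 2 * a ≠ 2 * c) (h4 : 2 * a ≠ -(2 * c))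
    (h5 : 2 * b ≠ 2 * c) (h6 : 2 * b ≠ -(2 * c)) : WilsonC4 S := by
  have h2a := h.two_mul_left_ne_zero hcard
  have h2b := h.swap_left.two_mul_left_ne_zero hcard
  have h2c := h.swap_right.swap_left.two_mul_left_ne_zero hcard
  set w : ZMod n × ZMod 2 := (ZMod.half n, 0) with hw
  have hfst : ∀ {x y : ZMod n × ZMod 2}, x = y → x.1 = y.1 := fun e => congrArg Prod.fst e
  rcases h.coverSet.parallel_or_of_two_mul_ne (w := w) hφ (card_coverSet.trans hcard)
      (fun e => ZMod.half_ne_zero hn (hfst e))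
      (Prod.ext (ZMod.two_mul_half hn) (mul_zero 2)) (Prod.ext hwb rfl)
      (Prod.ext hwc rfl) (fun e => h2a (hfst e)) (fun e => h2b (hfst e)) (fun e => h2c (hfst e))
      (fun e => h1 (hfst e)) (fun e => h2 (hfst e)) (fun e => h3 (hfst e)) (fun e => h4 (hfst e))
      (fun e => h5 (hfst e)) (fun e => h6 (hfst e))
      (fun x y => ZMod.two_mul_eq_of_four_mul_eq_zero hn) with hpar |
      ⟨⟨x, i⟩, ⟨y, j⟩, h10, hxy, hx, hy, hcy, h5x⟩
  · exact wilsonC4_of_parallel hn hφ htop h0 hτ hpar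
  · obtain ⟨hx, rfl : i = 1⟩ := mem_coverSet.1 hx
    obtain ⟨hy, rfl : j = 1⟩ := mem_coverSet.1 hy
    have := preservesDiff_flip_of_ten_mul_eq_zero hn (hfst h10) (hfst hxy) hcy h5x
    refine absurd ?_ hτ
    simpa [h0] using this.apply_add_of_singleton 0

end CirculantConnectionSets

/-! ### Verification of C.3' when b = a + n/2. -/

section WilsonConditions

variable {n : ℕ} [NeZero n] {S : Finset (ZMod n)} {φ : Equiv.Perm (ZMod n × ZMod 2)}
variable {a b c : ZMod n}

theorem gcdWithOrder_pair (c : ZMod n) : gcdWithOrder {c, -c} = Nat.gcd c.val n := by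
  have hsum : n ∣ c.val + (-c).val := by
    rw [← ZMod.natCast_eq_zero_iff]
    simp
  rw [gcdWithOrder, Finset.gcd_insert, Finset.gcd_singleton]
  refine Nat.dvd_antisymm (Nat.dvd_gcd ((Nat.gcd_dvd_left _ _).trans (Nat.gcd_dvd_left _ _))
    (Nat.gcd_dvd_right _ _)) (Nat.dvd_gcd (Nat.dvd_gcd (Nat.gcd_dvd_left _ _) ?_)
    (Nat.gcd_dvd_right _ _))
  rw [normalize_eq]
  exact (Nat.dvd_add_right (Nat.gcd_dvd_left c.val n)).1 ((Nat.gcd_dvd_right _ _).trans hsum)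

theorem mem_wilsonR {H : AddSubgroup (ZMod n)} {s : ZMod n} :
    s ∈ wilsonR S H ↔ s ∈ S ∧ ¬ ∀ h ∈ H, s + h ∈ S :=
  @Finset.mem_filter _ _ (_) _ _

theorem odd_val_div_gcd {c : ZMod n} (h : Even (n / Nat.gcd c.val n)) :
    Odd (c.val / Nat.gcd c.val n) := by
  rw [← Nat.not_even_iff_odd]
  intro h'
  have hco := Nat.coprime_div_gcd_div_gcd (Nat.gcd_pos_of_pos_right c.val (NeZero.pos n))
  exact Nat.not_coprime_of_dvd_of_dvd one_lt_two h'.two_dvd h.two_dvd hco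

/-- For R = {±c} the number d is gcd(c, n), and n/d is the order of c. Oddness of r/d is automatic,
since r/d and n/d are coprime. -/
theorem wilsonC3'_of_wilsonR_eq (hn : Even n) {H : AddSubgroup (ZMod n)}
    (hR : wilsonR S H = {c, -c}) (heven : Even (n / Nat.gcd c.val n))
    (hH : ¬ H ≤ AddSubgroup.zmultiples ((Nat.gcd c.val n : ℕ) : ZMod n) ∨
      H ≤ AddSubgroup.zmultiples ((2 * Nat.gcd c.val n : ℕ) : ZMod n)) : WilsonC3' S := by
  refine ⟨hn, H, by simp [hR], Nat.gcd c.val n, by rw [hR, gcdWithOrder_pair], heven, ?_, hH⟩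
  intro r hr
  have hgcd : Nat.gcd c.val n = Nat.gcd (-c).val n := by
    rw [← gcdWithOrder_pair, ← gcdWithOrder_pair, neg_neg, Finset.pair_comm]
  rw [hR, Finset.mem_insert, Finset.mem_singleton] at hr
  rcases hr with rfl | rfl
  · exact odd_val_div_gcd heven
  · rw [hgcd] at heven ⊢
    exact odd_val_div_gcd heven

theorem div_gcd_val_mul (c : ZMod n) : ((n / Nat.gcd c.val n : ℕ) : ZMod n) * c = 0 := by
  nth_rw 2 [← ZMod.natCast_zmod_val c]
  rw [← Nat.cast_mul, ZMod.natCast_eq_zero_iff]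
  obtain ⟨k, hk⟩ := Nat.gcd_dvd_left c.val n
  refine ⟨k, ?_⟩
  nth_rw 2 [hk]
  rw [← mul_assoc, Nat.div_mul_cancel (Nat.gcd_dvd_right _ _)]

theorem ZMod.natCast_mul_half_of_odd (hn : Even n) {k : ℕ} (hk : Odd k) :
    (k : ZMod n) * ZMod.half n = ZMod.half n := by
  obtain ⟨j, rfl⟩ := hk
  push_cast
  linear_combination j * ZMod.two_mul_half hn

/-- An odd k is its own inverse modulo 8; this replaces division by k in ℤ_n up to multiples of 8.
-/
theorem exists_sq_eq_of_odd {k : ℕ} (hk : Odd k) : ∃ m, k * k = 8 * m + 1 := by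
  obtain ⟨j, rfl⟩ := hk
  obtain ⟨m, hm⟩ := Nat.even_mul_succ_self j
  exact ⟨m, by linear_combination 4 * hm⟩

namespace IsSextuple

theorem ne_of_card (h : IsSextuple S a (a + ZMod.half n) c) (hn : Even n) (hcard : S.card = 6) :
    2 * a ≠ 2 * c ∧ 2 * a ≠ -(2 * c) ∧ 4 * a ≠ 0 := by
  have key : ∀ {c : ZMod n}, IsSextuple S a (a + ZMod.half n) c → 2 * a ≠ 2 * c := by
    intro c h e
    rcases (ZMod.two_mul_eq_zero_iff hn (c - a)).1 (by linear_combination -e) with e | e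
    · exact h.swap_right.left_ne_mid hcard (by linear_combination -e)
    · exact h.swap_left.swap_right.left_ne_mid hcard (by linear_combination -e)
  refine ⟨key h, fun e => key h.neg_right (by linear_combination e), fun e => ?_⟩
  rcases (ZMod.two_mul_eq_zero_iff hn (2 * a)).1 (by linear_combination e) with e | e
  · exact h.two_mul_left_ne_zero hcard e
  · exact h.neg_mid.left_ne_mid hcard (by linear_combination e + ZMod.two_mul_half hn)

/-- If 4c = 0 then 2c = n/2, so translation by n/2 exchanges c with −c as well as a with a + n/2,
and 0 and n/2 are twins. -/
theorem four_mul_right_ne_zero (h : IsSextuple S a (a + ZMod.half n) c) (hn : Even n)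
    (hcard : S.card = 6) (htwin : ∀ y, (∀ s, s ∈ S ↔ s - y ∈ S) → y = 0) : 4 * c ≠ 0 := by
  intro e
  have h2 := ZMod.two_mul_half hn
  have hc : 2 * c = ZMod.half n := by
    refine ((ZMod.two_mul_eq_zero_iff hn (2 * c)).1 (by linear_combination e)).resolve_left ?_
    exact h.swap_right.swap_left.two_mul_left_ne_zero hcard
  refine ZMod.half_ne_zero hn (htwin _ ?_)
  have key : ∀ s ∈ S, s - ZMod.half n ∈ S := by
    intro s hs
    rw [h] at hs ⊢
    rcases hs with rfl | rfl | rfl | rfl | rfl | rfl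
    · right; right; left; linear_combination -h2
    · right; right; right; left; ring
    · left; ring
    · right; left; linear_combination -h2
    · right; right; right; right; right; linear_combination hc
    · right; right; right; right; left; linear_combination -hc - h2
  refine fun s => ⟨key s, fun hs => ?_⟩
  have := key _ hs
  rwa [show s - ZMod.half n - ZMod.half n = s by linear_combination -h2] at this

/-- The last hypothesis says that the order n/d of c is divisible by 4. For H = ⟨n/2⟩ only ±c fail
to have their coset in S, and n/2 is a multiple of 2d. -/
theorem wilsonC3'_of_forall_odd (h : IsSextuple S a (a + ZMod.half n) c) (hn : Even n)
    (hcard : S.card = 6) (h4c : 4 * c ≠ 0)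
    (hodd : ∀ k : ℕ, Odd k → 2 * (k * c) ≠ 0) : WilsonC3' S := by
  have h2 := ZMod.two_mul_half hn
  have hz := div_gcd_val_mul c
  obtain ⟨m, hm⟩ : 4 ∣ n / Nat.gcd c.val n := by
    rcases Nat.even_or_odd (n / Nat.gcd c.val n) with ⟨k, hk⟩ | hk
    · rcases Nat.even_or_odd k with ⟨m, hm⟩ | hk'
      · exact ⟨m, by omega⟩
      · refine absurd ?_ (hodd k hk')
        rw [hk] at hz
        push_cast at hz
        linear_combination hz
    · exact absurd (by rw [hz, mul_zero]) (hodd _ hk)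
  have hcν : c + ZMod.half n ∉ S := by
    rw [h]
    rintro (e | e | e | e | e | e)
    · exact h.swap_left.swap_right.left_ne_mid hcard (by linear_combination -e + h2)
    · exact h.neg_right.swap_left.swap_right.left_ne_mid hcard (by linear_combination e)
    · exact h.swap_right.left_ne_mid hcard (by linear_combination -e)
    · exact h.neg_right.swap_right.left_ne_mid hcard (by linear_combination e - h2)
    · exact ZMod.half_ne_zero hn (by linear_combination e)
    · exact h4c (by linear_combination 2 * e - h2)
  refine wilsonC3'_of_wilsonR_eq (H := AddSubgroup.zmultiples (ZMod.half n)) (c := c) hn ?_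
    ⟨2 * m, by omega⟩ (.inr ?_)
  · ext s
    have hmem : (∀ z ∈ AddSubgroup.zmultiples (ZMod.half n), s + z ∈ S) ↔
        s ∈ S ∧ s + ZMod.half n ∈ S := by
      constructor
      · intro hs
        exact ⟨by simpa using hs 0 (zero_mem _), hs _ (AddSubgroup.mem_zmultiples _)⟩
      · rintro ⟨h0, h1⟩ z hz
        obtain ⟨y, rfl⟩ := ZMod.mem_zmultiples_iff.1 hz
        rw [mul_comm]
        rcases ZMod.half_mul hn y with e | e
        · rwa [e, add_zero]
        · rwa [e]
    rw [mem_wilsonR, hmem, Finset.mem_insert, Finset.mem_singleton]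
    constructor
    · rintro ⟨hs, hs'⟩
      have hs' : s + ZMod.half n ∉ S := fun e => hs' ⟨hs, e⟩
      rcases (h s).1 hs with rfl | rfl | rfl | rfl | rfl | rfl
      · exact absurd h.mid_mem hs'
      · exact absurd ((h _).2 (.inr (.inr (.inr (.inl (by linear_combination h2)))))) hs'
      · exact absurd ((h _).2 (.inl (by linear_combination h2))) hs'
      · exact absurd ((h _).2 (.inr (.inl (by ring)))) hs'
      · exact .inl rfl
      · exact .inr rfl
    · rintro (rfl | rfl)
      · exact ⟨h.right_mem, fun e => hcν e.2⟩
      · refine ⟨h.neg_mem _ h.right_mem, fun e => hcν ?_⟩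
        have := h.neg_mem _ e.2
        rwa [show -(-c + ZMod.half n) = c + ZMod.half n by linear_combination -h2] at this
  · rw [AddSubgroup.zmultiples_le, ZMod.mem_zmultiples_iff]
    refine ⟨m, ?_⟩
    have h' := Nat.div_mul_cancel (Nat.gcd_dvd_right c.val n)
    rw [hm] at h'
    rw [ZMod.half, ← Nat.cast_mul]
    congr 1
    rw [show m * (2 * Nat.gcd c.val n) = 2 * m * Nat.gcd c.val n by ring]
    have : 4 * m * Nat.gcd c.val n = 2 * (2 * m * Nat.gcd c.val n) := by ring
    omega

/-- Here 8a = 0, and {±a, ±(a + n/2)} is the coset a + ⟨2a⟩ of odd multiples of a, so H = ⟨2a⟩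
leaves R = {±c}. The order of c is twice an odd number, so n/d is even, while 2a has order four and
cannot lie in ⟨d⟩ = ⟨c⟩. -/
theorem wilsonC3'_of_four_mul_eq_half (h : IsSextuple S a (a + ZMod.half n) c) (hn : Even n)
    (hcard : S.card = 6) (h4a : 4 * a = ZMod.half n) {k : ℕ} (hk : Odd k)
    (hkc : k * c = ZMod.half n) : WilsonC3' S := by
  have h2 := ZMod.two_mul_half hn
  have hν := ZMod.half_ne_zero hn
  obtain ⟨hac, hac', -⟩ := h.ne_of_card hn hcard
  have h2a := h.two_mul_left_ne_zero hcard
  have hc2a : c + 2 * a ∉ S := by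
    rw [h]
    rintro (e | e | e | e | e | e)
    · exact h.neg_right.swap_right.left_ne_mid hcard (by linear_combination e)
    · exact h.swap_left.swap_right.left_ne_mid hcard (by linear_combination -e + h4a + h2)
    · exact h.neg_right.swap_left.swap_right.left_ne_mid hcard (by linear_combination e + h2)
    · exact h.swap_right.left_ne_mid hcard (by linear_combination -e + h4a + h2)
    · exact h2a (by linear_combination e)
    · exact hac' (by linear_combination e)
  refine wilsonC3'_of_wilsonR_eq (H := AddSubgroup.zmultiples (2 * a)) (c := c) hn ?_ ?_ (.inl ?_)
  · have hcoset : ∀ s ∈ S, s ≠ c → s ≠ -c → ∀ z ∈ AddSubgroup.zmultiples (2 * a), s + z ∈ S := by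
      have hstep : ∀ s ∈ S, s ≠ c → s ≠ -c → s + 2 * a ∈ S ∧ s + 2 * a ≠ c ∧ s + 2 * a ≠ -c := by
        have hA : ∀ s, s ∈ S ∧ s ≠ c ∧ s ≠ -c ↔
            s = a ∨ s = -a ∨ s = a + ZMod.half n ∨ s = -(a + ZMod.half n) := by
          intro s
          have h1 := h.swap_right.left_ne_mid hcard
          have h2 := h.neg_right.swap_right.left_ne_mid hcard
          have h3 := h.swap_left.swap_right.left_ne_mid hcard
          have h4 := h.neg_right.swap_left.swap_right.left_ne_mid hcard
          rw [h]
          constructor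
          · tauto
          · rintro (rfl | rfl | rfl | rfl)
            · exact ⟨.inl rfl, h1, h2⟩
            · exact ⟨.inr (.inl rfl), fun e => h2 (by linear_combination -e),
                fun e => h1 (by linear_combination -e)⟩
            · exact ⟨.inr (.inr (.inl rfl)), h3, h4⟩
            · exact ⟨.inr (.inr (.inr (.inl rfl))), fun e => h4 (by linear_combination -e),
                fun e => h3 (by linear_combination -e)⟩
        intro s hs h1 h1'
        rw [hA]
        rcases (hA s).1 ⟨hs, h1, h1'⟩ with rfl | rfl | rfl | rfl
        · right; right; right; linear_combination h4a + h2
        · left; ring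
        · right; left; linear_combination h4a + h2
        · right; right; left; linear_combination -h2
      intro s hs h1 h2 z hz
      obtain ⟨y, rfl⟩ := ZMod.mem_zmultiples_iff.1 hz
      have : ∀ j : ℕ, s + j * (2 * a) ∈ S ∧ s + j * (2 * a) ≠ c ∧ s + j * (2 * a) ≠ -c := by
        intro j
        induction j with
        | zero => simpa using ⟨hs, h1, h2⟩
        | succ j ih =>
          have := hstep _ ih.1 ih.2.1 ih.2.2
          rwa [add_assoc, ← add_one_mul, ← Nat.cast_succ] at this
      simpa using (this y.val).1
    ext s
    rw [mem_wilsonR, Finset.mem_insert, Finset.mem_singleton]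
    constructor
    · rintro ⟨hs, hs'⟩
      by_contra! hne
      exact hs' (hcoset s hs hne.1 hne.2)
    · rintro (rfl | rfl)
      · exact ⟨h.right_mem, fun e => hc2a (e _ (AddSubgroup.mem_zmultiples _))⟩
      · refine ⟨h.neg_mem _ h.right_mem, fun e => hc2a ?_⟩
        have := h.neg_mem _ (e _ (NegMemClass.neg_mem (AddSubgroup.mem_zmultiples _)))
        rwa [show -(-c + -(2 * a)) = c + 2 * a by ring] at this
  · rw [← Nat.not_odd_iff_even]
    intro hN
    refine hν ?_
    rw [← ZMod.natCast_mul_half_of_odd hn hN, ← hkc]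
    linear_combination k * div_gcd_val_mul c
  · intro hle
    obtain ⟨y, hy⟩ := ZMod.mem_zmultiples_iff.1 (hle (AddSubgroup.mem_zmultiples _))
    -- As n divides both 2kc and 2kn, 2k kills d and every multiple of it; but 2k·2a = k·n/2 = n/2.
    have hd : ((2 * k * Nat.gcd c.val n : ℕ) : ZMod n) = 0 := by
      rw [ZMod.natCast_eq_zero_iff, ← Nat.gcd_mul_left]
      refine Nat.dvd_gcd ?_ (dvd_mul_left _ _)
      rw [← ZMod.natCast_eq_zero_iff]
      push_cast
      rw [ZMod.natCast_zmod_val]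
      linear_combination 2 * hkc + h2
    push_cast at hd
    refine hν ?_
    rw [← ZMod.natCast_mul_half_of_odd hn hk, ← h4a]
    linear_combination 2 * k * hy + y * hd

end IsSextuple

end WilsonConditions

/-! ### The case b = a + n/2, by the order of c. -/

section CoincidentDoubles

variable {n : ℕ} [NeZero n] {S : Finset (ZMod n)} {φ : Equiv.Perm (ZMod n × ZMod 2)}
variable {a b c : ZMod n}

theorem PreservesDiff.apply_flip {x : ZMod n × ZMod 2} (h : PreservesDiff φ {x}) (h0 : φ 0 = 0) :
    φ x = x := by
  simpa [h0] using h.apply_add_of_singleton 0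

/-- From k² = 8m + 1 and kc = 0 follows c = −8mc. -/
theorem ZMod.eq_four_mul_of_odd {k : ℕ} (hk : Odd k) {c : ZMod n} (hkc : k * c = 0) :
    ∃ y, c = 4 * y := by
  obtain ⟨m, hm⟩ := exists_sq_eq_of_odd hk
  have hm : (k * k : ZMod n) = 8 * m + 1 := by exact_mod_cast congrArg (Nat.cast : ℕ → ZMod n) hm
  exact ⟨-(2 * m * c), by linear_combination -c * hm + k * hkc⟩

namespace IsSextuple

/-- The case where `c` has odd order. -/
theorem wilsonC2'_of_two_mul_eq (h : IsSextuple S a (a + ZMod.half n) c) (hn : Even n)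
    (hodd : ∃ s ∈ S, ZMod.half n * s = ZMod.half n) (hac : 2 * a = 2 * c + ZMod.half n)
    {k : ℕ} (hk : Odd k) (hkc : k * c = 0) : WilsonC2' S := by
  have h2 := ZMod.two_mul_half hn
  have hν := ZMod.half_ne_zero hn
  obtain ⟨y, hy⟩ := ZMod.eq_four_mul_of_odd hk hkc
  have hνν : ZMod.half n * ZMod.half n = 0 := by linear_combination (a - c) * h2 - ZMod.half n * hac
  have hνc : ZMod.half n * c = 0 := by linear_combination ZMod.half n * hy + 2 * y * h2
  have hνa : ZMod.half n * a = ZMod.half n := by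
    refine (ZMod.half_mul hn a).resolve_left fun e => ?_
    obtain ⟨s, hs, hs'⟩ := hodd
    refine hν (hs'.symm.trans ?_)
    rcases (h s).1 hs with rfl | rfl | rfl | rfl | rfl | rfl
    · exact e
    · linear_combination -e
    · linear_combination e + hνν
    · linear_combination -e - hνν
    · exact hνc
    · linear_combination -hνc
  have heven : ∀ x : ZMod n, x ∈ AddSubgroup.zmultiples (2 : ZMod n) ↔ ZMod.half n * x = 0 := by
    intro x
    rw [ZMod.half_mul_eq_zero_iff hn, ZMod.mem_zmultiples_iff]
    simp only [mul_comm]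
  have hfour : ∀ x : ZMod n, x ∈ AddSubgroup.zmultiples (4 : ZMod n) ↔ ∃ y, x = 4 * y := by
    intro x
    rw [ZMod.mem_zmultiples_iff]
    simp only [mul_comm]
  have hfour' : ∀ x : ZMod n, (∃ y, x = 4 * y) → ZMod.half n * x = 0 := by
    rintro x ⟨y, rfl⟩
    linear_combination 2 * y * h2
  -- n/2 = 2(a − c) with a − c odd; if it were 4z, then a − c − 2z would be 0 or n/2, both even.
  have hνfour : ¬ ∃ y, ZMod.half n = 4 * y := by
    rintro ⟨z, hz⟩
    rcases (ZMod.two_mul_eq_zero_iff hn (a - c - 2 * z)).1 (by linear_combination hac + hz) with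
      e | e
    · exact hν (by linear_combination ZMod.half n * e - hνa + hνc + z * h2)
    · exact hν (by linear_combination ZMod.half n * e - hνa + hνc + z * h2 + hνν)
  have hcν : ¬ ∃ z, c + ZMod.half n = 4 * z := by
    rintro ⟨z, hz⟩
    exact hνfour ⟨z - y, by linear_combination hz - hy⟩
  -- For h = a − c, adding 2h = n/2 exchanges a with a + n/2, and −a with −(a + n/2). Adding h sends
  -- c to a, −c to −(a + n/2), −a to −c and a + n/2 to c.
  refine ⟨?_, a - c, ?_, ?_, ?_⟩
  · have : Even (n / 2) := by
      rw [← Nat.not_odd_iff_even]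
      intro h'
      exact hν ((ZMod.half_mul_half_of_odd hn h').symm.trans hνν)
    obtain ⟨m, hm⟩ := this
    obtain ⟨m', hm'⟩ := hn
    exact ⟨m, by omega⟩
  · rw [heven]
    linear_combination hνa - hνc
  · have hmem : ∀ s, s ∈ oddPart S ↔ s ∈ S ∧ ZMod.half n * s ≠ 0 := by
      intro s
      rw [oddPart, Finset.mem_sdiff, evenPart, Finset.mem_filter, heven]
      tauto
    have hshift : ∀ s ∈ oddPart S, 2 * (a - c) + s ∈ oddPart S := by
      intro s hs
      rw [hmem] at hs ⊢
      obtain ⟨hs, hs'⟩ := hs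
      refine ⟨?_, fun e => hs' (by linear_combination e - (a - c) * h2)⟩
      rw [h]
      rcases (h s).1 hs with rfl | rfl | rfl | rfl | rfl | rfl
      · right; right; left; linear_combination hac
      · right; right; right; left; linear_combination hac + h2
      · left; linear_combination hac + h2
      · right; left; linear_combination hac
      · exact absurd hνc hs'
      · exact absurd (by linear_combination -hνc) hs'
    refine Finset.eq_of_subset_of_card_le ?_ ?_
    · intro x hx
      obtain ⟨s, hs, rfl⟩ := Finset.mem_image.1 hx
      exact hshift s hs
    · rw [Finset.card_image_of_injective _ (add_right_injective _)]
  -- The elements a and −(a + n/2) are exempt: they are odd, and congruence to −h would make c + n/2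
  -- divisible by 4.
  · intro s hs hs'
    rw [hfour, hfour] at hs'
    rw [h]
    rcases (h s).1 hs with rfl | rfl | rfl | rfl | rfl | rfl
    · rcases hs' with hs' | ⟨z, hz⟩
      · exact absurd (hνa.symm.trans (hfour' _ hs')) hν
      · exact absurd ⟨z, by linear_combination hz - hac⟩ hcν
    · right; right; right; right; right; ring
    · right; right; right; right; left; linear_combination hac + h2
    · rcases hs' with hs' | ⟨z, hz⟩
      · exact absurd (by linear_combination -hfour' _ hs' - hνa - hνν) hν
      · exact absurd ⟨-z, by linear_combination -hz⟩ hcν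
    · left; ring
    · right; right; right; left; linear_combination hac + h2

theorem coverSet_add_half (h : IsSextuple S a (a + ZMod.half n) c) :
    IsSextuple (_root_.coverSet S) ((a, 1) : ZMod n × ZMod 2) ((a, 1) + (ZMod.half n, 0)) (c, 1) := by
  have := h.coverSet
  rwa [show ((a + ZMod.half n, 1) : ZMod n × ZMod 2) = (a, 1) + (ZMod.half n, 0) from
    Prod.ext rfl (add_zero 1).symm] at this

/-- The case where `c` has twice an odd order. -/
theorem preservesDiff_flip_of_two_mul_eq (h : IsSextuple S a (a + ZMod.half n) c) (hn : Even n)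
    (hφ : PreservesDiff φ (_root_.coverSet S)) (h4a : 4 * a ≠ 0) (h4c : 4 * c ≠ 0)
    (h2c : 2 * c ≠ 0) (h1 : 2 * a ≠ 2 * c) (h2 : 2 * a ≠ -(2 * c))
    (hac : 2 * a = 2 * c + ZMod.half n) {k : ℕ} (hk : Odd k) (hkc : k * c = ZMod.half n) :
    PreservesDiff φ {((0, 1) : ZMod n × ZMod 2)} := by
  have hν2 := ZMod.two_mul_half hn
  have hν := ZMod.half_ne_zero hn
  have hfst : ∀ {x y : ZMod n × ZMod 2}, x = y → x.1 = y.1 := fun e => congrArg Prod.fst e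
  -- With k = 2j + 1, (j + 1)·2c = kc + c = c + n/2, and even multiples kill the second coordinate.
  -- The element u so obtained has odd order.
  have hu : PreservesDiff φ
      {((c + ZMod.half n, 0) : ZMod n × ZMod 2), -(c + ZMod.half n, 0)} := by
    have h2c := h.coverSet_add_half.preservesDiff_two_mul hφ (fun e => hν (hfst e))
      (Prod.ext hν2 (mul_zero 2)) (fun e => h4a (hfst e)) (fun e => h4c (hfst e))
      (fun e => h1 (hfst e)) (fun e => h2 (hfst e))
    obtain ⟨j, rfl⟩ := hk
    have := h2c.mul_pair (j + 1)
    have e : ((j + 1 : ℕ) : ZMod n × ZMod 2) * (2 * (c, 1)) = (c + ZMod.half n, 0) := by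
      refine Prod.ext ?_ ?_
      · rw [Prod.fst_mul, Prod.fst_natCast]
        show ((j + 1 : ℕ) : ZMod n) * (2 * c) = c + ZMod.half n
        rw [← hkc]
        push_cast
        ring
      · exact (by decide : ∀ i : ZMod 2, i * (2 * 1) = 0) _
    rwa [e] at this
  -- The element q = (a − c, 0) has order four with 2q = (n/2, 0). Over t = (0,1), the offsets q +
  -- u, 2q + u, 3q + u give a + n/2, c, a, and those with −u give the negatives −a, −c, −(a + n/2).
  refine PreservesDiff.singleton_of_tensor (q := (a - c, 0)) hφ hu ?_
    (Prod.ext (mul_zero 2) (show (2 : ZMod 2) * 1 = 0 by decide)) (Prod.ext ?_ (mul_zero 4))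
    (fun e => ?_) (fun e => ?_)
  · rintro ⟨x, i⟩
    have e1 : a - c + (c + ZMod.half n) = a + ZMod.half n := by ring
    have e2 : a - c - (c + ZMod.half n) = -a := by linear_combination hac
    have e3 : 2 * (a - c) + (c + ZMod.half n) = c := by linear_combination hac + hν2
    have e4 : 2 * (a - c) - (c + ZMod.half n) = -c := by linear_combination hac
    have e5 : 3 * (a - c) + (c + ZMod.half n) = a := by linear_combination hac + hν2
    have e6 : 3 * (a - c) - (c + ZMod.half n) = -(a + ZMod.half n) := by
      linear_combination 2 * hac + hν2
    have hp : ∀ y z : ZMod n, ((0, 1) : ZMod n × ZMod 2) + (y, 0) + (z, 0) = (y + z, 1) :=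
      fun y z => by simp
    have hm : ∀ y z : ZMod n, ((0, 1) : ZMod n × ZMod 2) + (y, 0) - (z, 0) = (y - z, 1) :=
      fun y z => by simp
    have h2' : (2 : ZMod n × ZMod 2) * (a - c, 0) = (2 * (a - c), 0) :=
      Prod.ext rfl (mul_zero 2)
    have h3' : (3 : ZMod n × ZMod 2) * (a - c, 0) = (3 * (a - c), 0) :=
      Prod.ext rfl (mul_zero 3)
    rw [h2', h3', hp, hp, hp, hm, hm, hm, e1, e2, e3, e4, e5, e6, mem_coverSet, h]
    simp only [Prod.mk.injEq]
    tauto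
  · show 4 * (a - c) = 0
    linear_combination 2 * hac + hν2
  · have e : 2 * (a - c) = 0 := hfst e
    exact hν (by linear_combination e - hac)
  · have e : 16 * (c + ZMod.half n) = 0 := hfst e
    obtain ⟨m, hm⟩ := exists_sq_eq_of_odd hk
    have hm : (k * k : ZMod n) = 8 * m + 1 := by
      exact_mod_cast congrArg (Nat.cast : ℕ → ZMod n) hm
    exact h2c (by
      linear_combination -2 * c * hm + 2 * k * hkc + k * hν2 - m * e + 8 * m * hν2)

/-- Two elements of the connection set differing by the element of order two. -/
theorem wilsonC2'_or_wilsonC3' (h : IsSextuple S a (a + ZMod.half n) c) (hn : Even n)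
    (hcard : S.card = 6) (htwin : ∀ y, (∀ s, s ∈ S ↔ s - y ∈ S) → y = 0)
    (hodd : ∃ s ∈ S, ZMod.half n * s = ZMod.half n) (hφ : PreservesDiff φ (_root_.coverSet S))
    (h0 : φ 0 = 0) (hτ : φ (0, 1) ≠ (0, 1)) : WilsonC2' S ∨ WilsonC3' S := by
  have hν2 := ZMod.two_mul_half hn
  have hν := ZMod.half_ne_zero hn
  have hflip : ¬ PreservesDiff φ {((0, 1) : ZMod n × ZMod 2)} := fun e => hτ (e.apply_flip h0)
  have h4c := h.four_mul_right_ne_zero hn hcard htwin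
  have h2c := h.swap_right.swap_left.two_mul_left_ne_zero hcard
  -- The order of c is odd or twice odd on one side, divisible by four on the other.
  by_cases hk : ∃ k : ℕ, Odd k ∧ 2 * (k * c) = 0
  · obtain ⟨k, hk, h2k⟩ := hk
    have key : ∀ c, IsSextuple S a (a + ZMod.half n) c → 4 * c ≠ 0 → 2 * c ≠ 0 →
        2 * (k * c) = 0 → 2 * a = 2 * c + ZMod.half n → WilsonC2' S := by
      intro c h h4c h2c h2k hac
      obtain ⟨h1, h2, h4a⟩ := h.ne_of_card hn hcard
      rcases (ZMod.two_mul_eq_zero_iff hn _).1 h2k with hkc | hkc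
      · exact h.wilsonC2'_of_two_mul_eq hn hodd hac hk hkc
      · exact absurd (h.preservesDiff_flip_of_two_mul_eq hn hφ h4a h4c h2c h1 h2 hac hk hkc) hflip
    by_cases hac : 2 * a = 2 * c + ZMod.half n
    · exact .inl (key c h h4c h2c h2k hac)
    by_cases hac' : 2 * a = -(2 * c) + ZMod.half n
    · exact .inl (key (-c) h.neg_right (fun e => h4c (by linear_combination -e))
        (fun e => h2c (by linear_combination -e)) (by linear_combination -h2k)
        (by linear_combination hac'))
    obtain ⟨h1, h2, h4a⟩ := h.ne_of_card hn hcard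
    have hfst : ∀ {x y : ZMod n × ZMod 2}, x = y → x.1 = y.1 := fun e => congrArg Prod.fst e
    have hC := h.coverSet_add_half.preservesDiff_right hφ (fun e => hν (hfst e))
      (Prod.ext hν2 (mul_zero 2)) (fun e => h4a (hfst e)) (fun e => h4c (hfst e))
      (fun e => h1 (hfst e)) (fun e => h2 (hfst e)) (fun e => hac (hfst e))
      (fun e => hac' (hfst e))
    -- As k is odd, k(c,1) = (kc,1), an involution in a preserved direction.
    have hkC : PreservesDiff φ {((k * c, 1) : ZMod n × ZMod 2)} := by
      have := hC.mul_pair k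
      have e : (k : ZMod n × ZMod 2) * (c, 1) = (k * c, 1) := by
        refine Prod.ext ?_ ?_
        · rw [Prod.fst_mul, Prod.fst_natCast]
        · rw [Prod.snd_mul, Prod.snd_natCast, mul_one]
          exact ZMod.natCast_eq_one_iff_odd.2 hk
      rw [e] at this
      exact this.singleton_of_two_mul_eq_zero
        (Prod.ext h2k (show (2 : ZMod 2) * 1 = 0 by decide))
    rcases (ZMod.two_mul_eq_zero_iff hn _).1 h2k with hkc | hkc
    · rw [hkc] at hkC
      exact absurd hkC hflip
    -- Unless 4a = n/2, translation by (n/2, 0) also commutes with φ, and combined with (kc,1) =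
    -- (n/2, 1) it gives (0,1).
    · by_cases h4a' : 4 * a = ZMod.half n
      · exact .inr (h.wilsonC3'_of_four_mul_eq_half hn hcard h4a' hk hkc)
      · have hV := h.coverSet_add_half.preservesDiff_involution hφ hC (fun e => hν (hfst e))
          (Prod.ext hν2 (mul_zero 2)) (fun e => h4a (hfst e)) (fun e => h4a' (hfst e))
          (fun e => h1 (hfst e)) (fun e => h2 (hfst e))
        rw [hkc] at hkC
        have := hkC.add_singleton hV
        rw [show ((ZMod.half n, 1) : ZMod n × ZMod 2) + (ZMod.half n, 0) = (0, 1) from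
          Prod.ext (by rw [Prod.fst_add, ← two_mul, hν2]) (add_zero 1)] at this
        exact absurd this hflip
  · push Not at hk
    exact .inr (h.wilsonC3'_of_forall_odd hn hcard h4c hk)

theorem wilsonC2'_or_wilsonC3'_of_two_mul_eq (h : IsSextuple S a b c) (hab : 2 * a = 2 * b)
    (hn : Even n) (hcard : S.card = 6) (htwin : ∀ y, (∀ s, s ∈ S ↔ s - y ∈ S) → y = 0)
    (hodd : ∃ s ∈ S, ZMod.half n * s = ZMod.half n) (hφ : PreservesDiff φ (_root_.coverSet S))
    (h0 : φ 0 = 0) (hτ : φ (0, 1) ≠ (0, 1)) : WilsonC2' S ∨ WilsonC3' S := by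
  have hb : b = a + ZMod.half n := by
    rcases (ZMod.two_mul_eq_zero_iff hn (b - a)).1 (by linear_combination -hab) with e | e
    · exact absurd (by linear_combination -e) (h.left_ne_mid hcard)
    · linear_combination e
  subst hb
  exact h.wilsonC2'_or_wilsonC3' hn hcard htwin hodd hφ h0 hτ

/-- The sextuple is arranged so that `a`, `b` have the same parity and `c` the other one. -/
theorem wilson_of_half_mul (h : IsSextuple S a b c)
    (hn : Even n) (hcard : S.card = 6) (htwin : ∀ y, (∀ s, s ∈ S ↔ s - y ∈ S) → y = 0)
    (htop : AddSubgroup.closure (_root_.coverSet S : Set (ZMod n × ZMod 2)) = ⊤)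
    (hodd : ∃ s ∈ S, ZMod.half n * s = ZMod.half n) (hφ : PreservesDiff φ (_root_.coverSet S))
    (h0 : φ 0 = 0) (hτ : φ (0, 1) ≠ (0, 1)) (hwb : ZMod.half n * b = ZMod.half n * a)
    (hwc : ZMod.half n * c = ZMod.half n * a + ZMod.half n) :
    WilsonC2' S ∨ WilsonC3' S ∨ WilsonC4 S := by
  rw [← or_assoc]
  by_cases h1 : 2 * a = 2 * b
  · exact .inl (h.wilsonC2'_or_wilsonC3'_of_two_mul_eq h1 hn hcard htwin hodd hφ h0 hτ)
  by_cases h2 : 2 * a = -(2 * b)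
  · exact .inl (h.neg_mid.wilsonC2'_or_wilsonC3'_of_two_mul_eq (by linear_combination h2)
      hn hcard htwin hodd hφ h0 hτ)
  by_cases h3 : 2 * a = 2 * c
  · exact .inl (h.swap_right.wilsonC2'_or_wilsonC3'_of_two_mul_eq h3 hn hcard htwin hodd hφ h0 hτ)
  by_cases h4 : 2 * a = -(2 * c)
  · exact .inl (h.neg_right.swap_right.wilsonC2'_or_wilsonC3'_of_two_mul_eq
      (by linear_combination h4) hn hcard htwin hodd hφ h0 hτ)
  by_cases h5 : 2 * b = 2 * c
  · exact .inl (h.swap_left.swap_right.wilsonC2'_or_wilsonC3'_of_two_mul_eq h5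
      hn hcard htwin hodd hφ h0 hτ)
  by_cases h6 : 2 * b = -(2 * c)
  · exact .inl (h.neg_right.swap_left.swap_right.wilsonC2'_or_wilsonC3'_of_two_mul_eq
      (by linear_combination h6) hn hcard htwin hodd hφ h0 hτ)
  exact .inr (wilsonC4_of_two_mul_ne hn h hcard hφ htop h0 hτ hwb hwc h1 h2 h3 h4 h5 h6)

end IsSextuple

end CoincidentDoubles

/-! ### The theorem. -/

theorem theorem5p1 (n : ℕ) [NeZero n] (S : Finset (ZMod n))
    (hzero : (0 : ZMod n) ∉ S) (hneg : ∀ s ∈ S, -s ∈ S)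
    (hval : (SimpleGraph.addCayley (S : Set (ZMod n))).IsRegularOfDegree 6)
    (hunst : IsNontriviallyUnstable (SimpleGraph.addCayley (S : Set (ZMod n)))) :
    WilsonC1 S ∨ WilsonC2' S ∨ WilsonC3' S ∨ WilsonC4 S := by
  obtain ⟨hconn, hbip, htf, hunst⟩ := hunst
  have htop := closure_coverSet hzero hneg hconn hbip
  obtain ⟨φ, hφ, h0, hτ⟩ := hunst.exists_perm hzero hneg htop
  have htwin : ∀ y, (∀ s, s ∈ S ↔ s - y ∈ S) → y = 0 := fun y => htf.eq_zero hzero hneg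
  rcases Nat.even_or_odd n with hn | hn
  swap
  · exact absurd (apply_flip_of_odd hn hφ htop h0 htwin) hτ
  -- One of the last three conditions always holds.
  refine .inr ?_
  have hcard := card_eq_of_isRegularOfDegree hzero hneg hval
  have hodd := exists_half_mul_eq_half hn (closure_eq_top_of_connected hzero hneg hconn)
  obtain ⟨s, hs, hs0⟩ := exists_half_mul_eq_zero hn hzero hneg hbip
  obtain ⟨t, ht, ht0⟩ := hodd
  obtain ⟨a, b, c, h⟩ := exists_isSextuple hn hzero hneg hcard
  have h2 := ZMod.two_mul_half hn
  have hν := ZMod.half_ne_zero hn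
  have key : ∀ {a b c : ZMod n}, IsSextuple S a b c → ZMod.half n * b = ZMod.half n * a →
      ZMod.half n * c = ZMod.half n * a + ZMod.half n → WilsonC2' S ∨ WilsonC3' S ∨ WilsonC4 S :=
    fun h => h.wilson_of_half_mul hn hcard htwin htop ⟨t, ht, ht0⟩ hφ h0 hτ
  -- S contains both an even and an odd element, and signs do not affect parity, so exactly one of
  -- a, b, c differs in parity from the other two; it is relabelled c.
  have hmix : ¬ ∃ e, ZMod.half n * a = e ∧ ZMod.half n * b = e ∧ ZMod.half n * c = e := by
    rintro ⟨e, ha, hb, hc⟩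
    have he : ∀ x ∈ S, ZMod.half n * x = e := by
      intro x hx
      rcases (h x).1 hx with rfl | rfl | rfl | rfl | rfl | rfl
      · exact ha
      · linear_combination -a * h2 + ha
      · exact hb
      · linear_combination -b * h2 + hb
      · exact hc
      · linear_combination -c * h2 + hc
    exact hν (ht0.symm.trans ((he t ht).trans ((he s hs).symm.trans hs0)))
  rcases ZMod.half_mul hn a with ha | ha <;> rcases ZMod.half_mul hn b with hb | hb <;>
    rcases ZMod.half_mul hn c with hc | hc
  · exact absurd ⟨_, ha, hb, hc⟩ hmix
  · exact key h (hb.trans ha.symm) (by rw [hc, ha, zero_add])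
  · exact key h.swap_right (hc.trans ha.symm) (by rw [hb, ha, zero_add])
  · exact key h.swap_left.swap_right (hc.trans hb.symm) (by rw [ha, hb, ← two_mul, h2])
  · exact key h.swap_left.swap_right (hc.trans hb.symm) (by rw [ha, hb, zero_add])
  · exact key h.swap_right (hc.trans ha.symm) (by rw [hb, ha, ← two_mul, h2])
  · exact key h (hb.trans ha.symm) (by rw [hc, ha, ← two_mul, h2])
  · exact absurd ⟨_, ha, hb, hc⟩ hmix
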